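/- Let $\mathsf{gr}$ be the category of finitely generated free groups and group homomorphisms, let $\mathcal{F}(\mathsf{gr};\mathbb{Z})$ be the abelian category of functors from $\mathsf{gr}$ to abelian groups, and let $\mathfrak{a}\colon G\mapsto G/[G,G]$ be the abelianization functor. Let $T^c$ and $\Lambda^d$ denote the $c$-th tensor power and the $d$-th exterior power of abelian groups (over $\mathbb{Z}$). Let $R(d,c)$ be the set of ordered partitions of $d$ into $c$ parts, i.e. the set of orbits $S_d\backslash\mathrm{Surj}(d,c)$ of the symmetric group $S_d$ acting, by permutation of the source, on the set of surjections $\{1,\dots,d\}\to\{1,\dots,c\}$. Then for all integers $c,d\ge 1$ and all integers $i\ge 0$ there is an isomorphism of abelian groups $$\mathrm{Ext}^i_{\mathcal{F}(\mathsf{gr};\mathbb{Z})}(T^c\circ\mathfrak{a},\Lambda^d\circ\mathfrak{a})\cong\begin{cases}\mathbb{Z}[R(d,c)] & \text{if } i=d-c,\\ 0 & \text{otherwise,}\end{cases}$$ where $\mathbb{Z}[R(d,c)]$ is the free abelian group on $R(d,c)$. -/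

import Mathlib

open CategoryTheory
open scoped TensorProduct

namespace FunctorsOnFreeGroups

/-- A group is finitely generated and free. -/
def isFGFree : ObjectProperty GrpCat.{0} := fun G => IsFreeGroup G ∧ Group.FG G

/-- The category `gr` of finitely generated free groups and group homomorphisms. -/
abbrev Gr : Type 1 := isFGFree.FullSubcategory

/-- The category of functors from `gr` to abelian groups (that is, to `ℤ`-modules). -/
abbrev FGr : Type 1 := Gr ⥤ ModuleCat.{0} ℤ

/-- The abelianization functor, `G ↦ G/[G,G]` written additively. -/
noncomputable def abelianization : GrpCat.{0} ⥤ ModuleCat.{0} ℤ where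
  obj G := ModuleCat.of ℤ (Additive (Abelianization G))
  map f := ModuleCat.ofHom (MonoidHom.toAdditive (Abelianization.map f.hom)).toIntLinearMap
  map_id G := by
    apply ModuleCat.hom_ext
    apply LinearMap.ext
    intro x
    exact DFunLike.congr_fun (Abelianization.map_id (G := G)) (Additive.toMul x)
  map_comp {G H K} f g := by
    apply ModuleCat.hom_ext
    apply LinearMap.ext
    intro x
    exact (DFunLike.congr_fun (Abelianization.map_comp f.hom g.hom) (Additive.toMul x)).symm

/-- The abelianization functor `𝔞` on finitely generated free groups. -/
noncomputable def 𝔞 : FGr := isFGFree.ι ⋙ abelianization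

/-- The `c`-th tensor power functor `T^c`, `A ↦ A ⊗ ⋯ ⊗ A` over `ℤ`. -/
noncomputable def tensorPower (c : ℕ) : ModuleCat.{0} ℤ ⥤ ModuleCat.{0} ℤ where
  obj A := ModuleCat.of ℤ (⨂[ℤ]^c A)
  map f := ModuleCat.ofHom (PiTensorProduct.map (fun _ : Fin c => f.hom))
  map_id A := by
    apply ModuleCat.hom_ext
    exact PiTensorProduct.map_id
  map_comp {A B C} f g := by
    apply ModuleCat.hom_ext
    exact PiTensorProduct.map_comp (fun _ : Fin c => g.hom) (fun _ : Fin c => f.hom)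

/-- The `d`-th exterior power functor `Λ^d` over `ℤ`. -/
noncomputable abbrev exteriorPower (d : ℕ) : ModuleCat.{0} ℤ ⥤ ModuleCat.{0} ℤ :=
  ModuleCat.exteriorPower.functor ℤ d

/-- The Ext-groups of the abelian category of functors on `gr` are defined in `Type 1`. -/
instance : HasExt.{1} FGr := HasExt.standard FGr

/-- The set of surjections from a set with `d` elements to a set with `c` elements. -/
abbrev Surj (d c : ℕ) : Type := {f : Fin d → Fin c // Function.Surjective f}

/-- Two surjections are related when they are in the same orbit of the symmetric group `S_d`
acting by permutation of the source. -/
def surjSetoid (d c : ℕ) : Setoid (Surj d c) where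
  r f g := ∃ σ : Equiv.Perm (Fin d), ∀ x, g.1 x = f.1 (σ x)
  iseqv :=
    { refl := fun _ => ⟨1, fun _ => rfl⟩
      symm := fun ⟨σ, h⟩ => ⟨σ⁻¹, fun x => by rw [h]; simp⟩
      trans := fun ⟨σ, h⟩ ⟨τ, k⟩ => ⟨σ * τ, fun x => by rw [k, h]; rfl⟩ }

/-- The set `R(d,c)` of ordered partitions of `d` into `c` parts: the orbits of `S_d` on the
surjections from `{1,…,d}` to `{1,…,c}`. -/
def R (d c : ℕ) : Type := Quotient (surjSetoid d c)

end FunctorsOnFreeGroups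

namespace FunctorsOnFreeGroups

/-! ### Dimension shifting for Ext concentrated in one degree. -/

section Homological

open Limits Abelian

universe w v u

/-- An extension of `S →₀ ℤ` by `T →₀ ℤ` is isomorphic to `(S ⊕ T) →₀ ℤ`. -/
lemma nonempty_addEquiv_sum_finsupp {A B D : Type*} [AddCommGroup A] [AddCommGroup B]
    [AddCommGroup D] {S T : Type} (eA : A ≃+ (T →₀ ℤ)) (eD : D ≃+ (S →₀ ℤ))
    (f : A →+ B) (g : B →+ D) (hf : Function.Injective f) (hg : Function.Surjective g)
    (h : Function.Exact f g) : Nonempty (B ≃+ (S ⊕ T →₀ ℤ)) := by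
  have : Module.Projective ℤ D := Module.Projective.of_equiv eD.symm.toIntLinearEquiv
  obtain ⟨l, hl⟩ := Module.projective_lifting_property g.toIntLinearMap LinearMap.id hg
  obtain ⟨e, -⟩ := Function.Exact.splitSurjectiveEquiv (f := f.toIntLinearMap)
    (g := g.toIntLinearMap) h hf ⟨l, hl⟩
  exact ⟨e.toAddEquiv.trans ((eA.prodCongr eD).trans
    ((AddEquiv.prodComm).trans (Finsupp.sumFinsuppAddEquivProdFinsupp).symm))⟩

variable {C : Type u} [Category.{v} C] [Abelian C]

/-- The sequence `⋯ ⟶ X 1 ⟶ X 0 ⟶ Y ⟶ 0` is exact. -/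
structure IsLeftResolution (X : ℕ → C) (d : ∀ n, X (n + 1) ⟶ X n) {Y : C} (ε : X 0 ⟶ Y) :
    Prop where
  epi : Epi ε
  comp_zero : d 0 ≫ ε = 0
  exact_zero : (ShortComplex.mk _ _ comp_zero).Exact
  comp : ∀ n, d (n + 1) ≫ d n = 0
  exact : ∀ n, (ShortComplex.mk _ _ (comp n)).Exact

/-- The tail of a resolution resolves the first syzygy; the inductions on Ext-degree rest on this
shift. -/
lemma IsLeftResolution.kernel {X : ℕ → C} {d : ∀ n, X (n + 1) ⟶ X n} {Y : C} {ε : X 0 ⟶ Y}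
    (h : IsLeftResolution X d ε) :
    IsLeftResolution (fun n => X (n + 1)) (fun n => d (n + 1))
      (kernel.lift ε (d 0) h.comp_zero) where
  epi := (ShortComplex.exact_iff_epi_kernel_lift _).1 h.exact_zero
  comp_zero := by simp [← cancel_mono (kernel.ι ε), h.comp]
  exact_zero := by
    let φ : ShortComplex.mk (d (0 + 1)) (kernel.lift ε (d 0) h.comp_zero)
        (by simp [← cancel_mono (kernel.ι ε), h.comp]) ⟶ ShortComplex.mk _ _ (h.comp 0) :=
      { τ₁ := 𝟙 _, τ₂ := 𝟙 _, τ₃ := kernel.ι ε }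
    have : Epi φ.τ₁ := inferInstanceAs (Epi (𝟙 _))
    have : IsIso φ.τ₂ := inferInstanceAs (IsIso (𝟙 _))
    have : Mono φ.τ₃ := inferInstanceAs (Mono (kernel.ι ε))
    exact (ShortComplex.exact_iff_of_epi_of_isIso_of_mono φ).2 (h.exact 0)
  comp n := h.comp (n + 1)
  exact n := h.exact (n + 1)

lemma shortExact_kernel {X Y : C} (ε : X ⟶ Y) [Epi ε] :
    (ShortComplex.mk (kernel.ι ε) ε (kernel.condition ε)).ShortExact where
  exact := ShortComplex.exact_of_f_is_kernel _ (kernelIsKernel ε)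

variable [HasExt.{w} C]

/-- The groups `Ext^i(X, F)` vanish for `i ≠ e`, and `Ext^e(X, F)` is free abelian on `S`. -/
structure ExtConcentrated (X F : C) (e : ℤ) (S : Type) : Prop where
  -- The degree is an integer so that inductions may pass below zero. No Ext-group remains there to
  -- control `S`, so emptiness has to be recorded separately.
  isEmpty : e < 0 → IsEmpty S
  equiv : ∀ i : ℕ, (i : ℤ) = e → Nonempty (Ext X F i ≃+ (S →₀ ℤ))
  subsingleton : ∀ i : ℕ, (i : ℤ) ≠ e → Subsingleton (Ext X F i)

/-- An isomorphism induces isomorphisms on Ext-groups. -/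
noncomputable def extCongrLeft {X X' : C} (φ : X ≅ X') (F : C) (i : ℕ) :
    Ext X F i ≃+ Ext X' F i where
  toFun x := (Ext.mk₀ φ.inv).comp x (zero_add i)
  invFun x := (Ext.mk₀ φ.hom).comp x (zero_add i)
  left_inv x := by simp
  right_inv x := by simp
  map_add' x y := by simp

lemma ExtConcentrated.of_iso {X X' F : C} {e : ℤ} {S : Type} (h : ExtConcentrated X F e S)
    (φ : X ≅ X') : ExtConcentrated X' F e S where
  isEmpty := h.isEmpty
  equiv i hi := by
    obtain ⟨f⟩ := h.equiv i hi
    exact ⟨(extCongrLeft φ F i).symm.trans f⟩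
  subsingleton i hi :=
    have := h.subsingleton i hi
    (extCongrLeft φ F i).symm.injective.subsingleton

lemma ExtConcentrated.of_equiv {X F : C} {e e' : ℤ} {S S' : Type} (h : ExtConcentrated X F e S)
    (he : e = e') (φ : S ≃ S') : ExtConcentrated X F e' S' := by
  subst he
  refine ⟨fun he => φ.symm.isEmpty_congr.2 (h.isEmpty he), fun i hi => ?_, h.subsingleton⟩
  obtain ⟨f⟩ := h.equiv i hi
  exact ⟨f.trans (Finsupp.domCongr φ)⟩

/-- An isomorphism of the second argument induces isomorphisms on Ext-groups. -/
noncomputable def extCongrRight (X : C) {F F' : C} (φ : F ≅ F') (i : ℕ) :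
    Ext X F i ≃+ Ext X F' i where
  toFun x := x.comp (Ext.mk₀ φ.hom) (add_zero i)
  invFun x := x.comp (Ext.mk₀ φ.inv) (add_zero i)
  left_inv x := by simp
  right_inv x := by simp
  map_add' x y := by simp

lemma ExtConcentrated.of_iso_right {X F F' : C} {e : ℤ} {S : Type} (h : ExtConcentrated X F e S)
    (φ : F ≅ F') : ExtConcentrated X F' e S where
  isEmpty := h.isEmpty
  equiv i hi := by
    obtain ⟨f⟩ := h.equiv i hi
    exact ⟨(extCongrRight X φ i).symm.trans f⟩
  subsingleton i hi :=
    have := h.subsingleton i hi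
    (extCongrRight X φ i).symm.injective.subsingleton

/-- Ext-groups of the quotient in a short exact sequence, from those of the other two objects. -/
lemma ExtConcentrated.of_shortExact {E : ShortComplex C} (hE : E.ShortExact) {F : C} {e : ℤ}
    {S T : Type} (h₁ : ExtConcentrated E.X₁ F (e - 1) T) (h₂ : ExtConcentrated E.X₂ F e S) :
    ExtConcentrated E.X₃ F e (S ⊕ T) where
  isEmpty he := by
    have := h₂.isEmpty he
    have := h₁.isEmpty (by lia)
    infer_instance
  equiv i hi := by
    have := h₁.subsingleton i (by lia)
    obtain ⟨φ₂⟩ := h₂.equiv i hi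
    -- The long exact sequence reduces to 0 → Ext^(e-1)(X₁) → Ext^e(X₃) → Ext^e(X₂) → 0, because
    -- Ext^e(X₁) and Ext^(e-1)(X₂) vanish. It splits since the quotient is free.
    have hsurj : Function.Surjective ((Ext.mk₀ E.g).precomp F (zero_add i)) := fun x =>
      Ext.contravariant_sequence_exact₂ hE F x (Subsingleton.elim _ _)
    obtain _ | j := i
    -- In degree zero the left term is absent, and `T` is empty because e - 1 is negative.
    · have := h₁.isEmpty (by lia)
      exact ⟨(AddEquiv.ofBijective ((Ext.mk₀ E.g).precomp F (zero_add 0))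
        ⟨have := hE.epi_g; Ext.precomp_mk₀_injective_of_epi _ _, hsurj⟩).trans
          (φ₂.trans (Finsupp.domCongr (Equiv.sumEmpty S T).symm))⟩
    · obtain ⟨φ₁⟩ := h₁.equiv j (by push_cast at hi; lia)
      have := h₂.subsingleton j (by push_cast at hi; lia)
      refine nonempty_addEquiv_sum_finsupp φ₁ φ₂ (hE.extClass.precomp F (add_comm 1 j))
        ((Ext.mk₀ E.g).precomp F (zero_add (j + 1))) ?_ hsurj ?_
      · rw [injective_iff_map_eq_zero]
        intro x hx
        obtain ⟨y, rfl⟩ := Ext.contravariant_sequence_exact₁ hE F x (add_comm 1 j) hx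
        rw [Subsingleton.elim y 0, Ext.comp_zero]
      · have := Ext.contravariant_sequence_exact₃' hE F j (j + 1) (add_comm 1 j)
        exact (ShortComplex.ab_exact_iff_function_exact _).1 this
  subsingleton i hi := by
    have := h₂.subsingleton i hi
    refine ⟨fun x y => ?_⟩
    obtain _ | j := i
    · have := hE.epi_g
      exact Ext.precomp_mk₀_injective_of_epi F E.g (Subsingleton.elim _ _)
    · have := h₁.subsingleton j (by push_cast at hi; lia)
      have key : ∀ z : Ext E.X₃ F (j + 1), z = 0 := fun z => by
        obtain ⟨t, rfl⟩ := Ext.contravariant_sequence_exact₃ hE F z (Subsingleton.elim _ _)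
          (add_comm 1 j)
        rw [Subsingleton.elim t 0, Ext.comp_zero]
      rw [key x, key y]

lemma IsLeftResolution.subsingleton_ext {F : C} (i : ℕ) : ∀ {X : ℕ → C}
    {d : ∀ n, X (n + 1) ⟶ X n} {Y : C} {ε : X 0 ⟶ Y}, IsLeftResolution X d ε →
    (∀ n i, Subsingleton (Ext (X n) F i)) → Subsingleton (Ext Y F i) := by
  induction i with
  | zero =>
    intro X d Y ε h hX
    have := h.epi
    have := hX 0 0
    exact (Ext.precomp_mk₀_injective_of_epi F ε).subsingleton
  | succ j ih =>
    intro X d Y ε h hX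
    have := h.epi
    have := ih h.kernel fun n i => hX (n + 1) i
    have := hX 0 (j + 1)
    have key : ∀ z : Ext Y F (j + 1), z = 0 := fun z => by
      obtain ⟨t, rfl⟩ := Ext.contravariant_sequence_exact₃ (shortExact_kernel ε) F z
        (Subsingleton.elim (α := Ext (X 0) F (j + 1)) _ _) (add_comm 1 j)
      rw [Subsingleton.elim (α := Ext (Limits.kernel ε) F j) t 0, Ext.comp_zero]
    exact ⟨fun x y => (key x).trans (key y).symm⟩

/-- Splitting off the first summand of a sum indexed by `ℕ`. -/
def sigmaNatEquiv (S : ℕ → Type) : (S 0 ⊕ Σ n, S (n + 1)) ≃ Σ n, S n where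
  toFun := Sum.elim (fun s => ⟨0, s⟩) fun p => ⟨p.1 + 1, p.2⟩
  invFun
    | ⟨0, s⟩ => .inl s
    | ⟨n + 1, s⟩ => .inr ⟨n, s⟩
  left_inv := by rintro (s | ⟨n, s⟩) <;> rfl
  right_inv := by rintro ⟨_ | n, s⟩ <;> rfl

/-- If the Ext-groups of the terms of a left resolution all contribute to the same total degree
`e` and are free, then the Ext-groups of the resolved object are concentrated in degree `e`. -/
lemma IsLeftResolution.extConcentrated {F : C} (m : ℕ) : ∀ {X : ℕ → C}
    {d : ∀ n, X (n + 1) ⟶ X n} {Y : C} {ε : X 0 ⟶ Y} {e : ℤ} {S : ℕ → Type}, e < m →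
    IsLeftResolution X d ε → (∀ n : ℕ, ExtConcentrated (X n) F (e - n) (S n)) →
    ExtConcentrated Y F e (Σ n, S n) := by
  induction m with
  | zero =>
    intro X d Y ε e S he h hX
    -- Here e < 0, so every e - n is negative and all Ext-groups of all terms vanish.
    have hS : ∀ n, IsEmpty (S n) := fun n => (hX n).isEmpty (by push_cast at he; lia)
    have hY : ∀ i, Subsingleton (Ext Y F i) := fun i => h.subsingleton_ext i
      fun n i => (hX n).subsingleton i (by push_cast at he; lia)
    exact ⟨fun _ => isEmpty_sigma.2 hS, fun i hi => by push_cast at he; lia, fun i _ => hY i⟩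
  | succ m ih =>
    intro X d Y ε e S he h hX
    have := h.epi
    have hK : ExtConcentrated (Limits.kernel ε) F (e - 1) (Σ n, S (n + 1)) :=
      ih (by push_cast at he; lia) h.kernel fun n =>
        (hX (n + 1)).of_equiv (by push_cast; ring) (Equiv.refl _)
    have h0 : ExtConcentrated (X 0) F e (S 0) := (hX 0).of_equiv (by simp) (Equiv.refl _)
    exact (ExtConcentrated.of_shortExact (shortExact_kernel ε) hK h0).of_equiv rfl
      (sigmaNatEquiv S)

end Homological

end FunctorsOnFreeGroups

namespace FunctorsOnFreeGroups

/-! ### The reduced group ring as a ring without unit. -/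

section ReducedGroupRing

/-- The reduced group ring `k[G]/k·1`; as a ring without unit it is the augmentation ideal, with
the class of `g` corresponding to `g - 1`. -/
abbrev RedGroupRing (k G : Type) [CommRing k] [Group G] : Type :=
  (G →₀ k) ⧸ Submodule.span k {(Finsupp.single 1 1 : G →₀ k)}

variable {k : Type} [CommRing k] {G H A : Type} [Group G] [Group H] [AddCommGroup A] [Module k A]

namespace RedGroupRing

variable (k) in
/-- The class of `g` in the reduced group ring. -/
noncomputable def of (g : G) : RedGroupRing k G := Submodule.Quotient.mk (Finsupp.single g 1)

@[simp]
lemma of_one : of k (1 : G) = 0 :=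
  (Submodule.Quotient.mk_eq_zero _).2 (Submodule.mem_span_singleton_self _)

/-- The linear map induced by a function that vanishes on `1`. -/
noncomputable def lift (f : G → A) (hf : f 1 = 0) : RedGroupRing k G →ₗ[k] A :=
  Submodule.liftQ _ (Finsupp.lift A k G f) (by
    rw [Submodule.span_singleton_le_iff_mem]
    simp [hf])

@[simp]
lemma lift_of (f : G → A) (hf : f 1 = 0) (g : G) : lift f hf (of k g) = f g := by
  simp [lift, of]

lemma hom_ext {f g : RedGroupRing k G →ₗ[k] A} (h : ∀ x, f (of k x) = g (of k x)) : f = g := by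
  apply Submodule.linearMap_qext
  ext x
  exact h x

lemma hom_ext_apply {f g : RedGroupRing k G →ₗ[k] A} (h : ∀ x, f (of k x) = g (of k x))
    (b : RedGroupRing k G) : f b = g b := by
  rw [hom_ext h]

lemma induction {P : RedGroupRing k G → Prop} (of : ∀ g, P (of k g))
    (add : ∀ a b, P a → P b → P (a + b)) (smul : ∀ (r : k) a, P a → P (r • a))
    (a : RedGroupRing k G) : P a := by
  let S : Submodule k (RedGroupRing k G) :=
    { carrier := {a | P a}
      add_mem' := fun {a b} => add a b
      zero_mem' := by simpa using of 1
      smul_mem' := fun r a => smul r a }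
  have : S.mkQ = 0 := hom_ext fun x => (Submodule.Quotient.mk_eq_zero _).2 (of x)
  exact (Submodule.Quotient.mk_eq_zero _).1 (LinearMap.congr_fun this a)

/-- The multiplication of the reduced group ring, `[g][h] = [gh] - [g] - [h]`. -/
noncomputable def mul : RedGroupRing k G →ₗ[k] RedGroupRing k G →ₗ[k] RedGroupRing k G :=
  lift (fun g => lift (fun h => of k (g * h) - of k g - of k h) (by simp))
    (hom_ext fun x => by simp)

@[simp]
lemma mul_of_of (g h : G) : mul (of k g) (of k h) = of k (g * h) - of k g - of k h := by
  simp [mul]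

lemma mul_assoc (a b c : RedGroupRing k G) : mul (mul a b) c = mul a (mul b c) := by
  induction a using RedGroupRing.induction with
  | add x y hx hy => simp only [map_add, LinearMap.add_apply, hx, hy]
  | smul r x hx => simp only [map_smul, LinearMap.smul_apply, hx]
  | of x =>
  induction b using RedGroupRing.induction with
  | add x y hx hy => simp only [map_add, LinearMap.add_apply, hx, hy]
  | smul r x hx => simp only [map_smul, LinearMap.smul_apply, hx]
  | of y =>
  refine hom_ext_apply (f := mul (mul (of k x) (of k y))) (g := mul (of k x) ∘ₗ mul (of k y))
    (fun z => ?_) c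
  simp only [LinearMap.comp_apply, mul_of_of, map_sub, LinearMap.sub_apply, _root_.mul_assoc]
  abel

variable (k) in
/-- Functoriality of the reduced group ring. -/
noncomputable def map (f : G →* H) : RedGroupRing k G →ₗ[k] RedGroupRing k H :=
  lift (fun g => of k (f g)) (by simp)

@[simp]
lemma map_of (f : G →* H) (g : G) : map k f (of k g) = of k (f g) := by simp [map]

lemma map_mul (f : G →* H) (a b : RedGroupRing k G) :
    map k f (mul a b) = mul (map k f a) (map k f b) := by
  have : mul.compr₂ (map k f) = mul.compl₁₂ (map k f) (map k f) :=
    hom_ext fun x => hom_ext fun y => by simp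
  exact LinearMap.congr_fun₂ this a b

end RedGroupRing

end ReducedGroupRing

/-! ### Fox calculus and the contraction of the augmentation ideal. -/

section Fox

open RedGroupRing

variable {k : Type} [CommRing k] {G : Type} [Group G]

/-- Left translation on `A[G]`. -/
noncomputable def translation (G A : Type) [Group G] [AddCommGroup A] :
    G →* MulAut (Multiplicative (G →₀ A)) where
  toFun g := AddEquiv.toMultiplicative (Finsupp.domCongr (Equiv.mulLeft g))
  map_one' := by
    ext x : 1
    apply Multiplicative.toAdd.injective
    ext y
    exact congrArg (DFunLike.coe (F := G →₀ A) (Multiplicative.toAdd x))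
      (by simp : (1 : G)⁻¹ * y = y)
  map_mul' g h := by
    ext x : 1
    apply Multiplicative.toAdd.injective
    ext y
    exact congrArg (DFunLike.coe (F := G →₀ A) (Multiplicative.toAdd x))
      (by simp [_root_.mul_assoc] : (g * h)⁻¹ * y = h⁻¹ * (g⁻¹ * y))

/-- The universal crossed homomorphism on a free group (the total Fox derivative). -/
lemma exists_foxDerivative [IsFreeGroup G] : ∃ D : G → (G →₀ RedGroupRing k G),
    (∀ g h, D (g * h) = D g + Finsupp.mapDomain (g * ·) (D h)) ∧
    ∀ x : IsFreeGroup.Generators G, D (IsFreeGroup.of x) =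
      Finsupp.single 1 (of k (IsFreeGroup.of x)) := by
  -- A crossed homomorphism is the left component of a section of the semidirect product, and on a
  -- free group a section can be prescribed on generators.
  let F : G →* Multiplicative (G →₀ RedGroupRing k G) ⋊[translation G (RedGroupRing k G)] G :=
    IsFreeGroup.lift fun x => ⟨Multiplicative.ofAdd
      (Finsupp.single 1 (of k (IsFreeGroup.of x))), IsFreeGroup.of x⟩
  have hF : SemidirectProduct.rightHom.comp F = MonoidHom.id G := by
    apply IsFreeGroup.ext_hom
    intro x
    simp [F]
  have hF' (g : G) : (F g).right = g := DFunLike.congr_fun hF g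
  refine ⟨fun g => (F g).left.toAdd, fun g h => ?_, fun x => by simp [F]⟩
  beta_reduce
  rw [_root_.map_mul, SemidirectProduct.mul_left, hF', toAdd_mul]
  congr 1
  exact Finsupp.equivMapDomain_eq_mapDomain _ _

lemma isFreeGroup_induction [IsFreeGroup G] {P : G → Prop} (one : P 1)
    (gen : ∀ x : IsFreeGroup.Generators G, P (IsFreeGroup.of x))
    (mul : ∀ x y, P x → P y → P (x * y)) (inv : ∀ x, P x → P x⁻¹) (g : G) : P g := by
  let S : Subgroup G := ⟨⟨⟨{g | P g}, fun {a b} => mul a b⟩, one⟩, fun {a} => inv a⟩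
  let F : G →* S := IsFreeGroup.lift fun x => ⟨IsFreeGroup.of x, gen x⟩
  have hF : S.subtype.comp F = MonoidHom.id G := by
    apply IsFreeGroup.ext_hom
    intro x
    simp [F]
  have := (F g).2
  rwa [show ((F g : S) : G) = g from DFunLike.congr_fun hF g] at this

/-- For a free group, the reduced group ring is a contractible module over itself. -/
lemma exists_contraction [IsFreeGroup G] :
    ∃ s : RedGroupRing k G →ₗ[k] RedGroupRing k G ⊗[k] RedGroupRing k G, ∀ b c,
      s (mul b c) = (mul b).rTensor _ (s c) - b ⊗ₜ TensorProduct.lift mul (s c) + b ⊗ₜ c := by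
  obtain ⟨D, hmul, hgen⟩ := exists_foxDerivative (k := k) (G := G)
  have hone : D 1 = 0 := by
    have := hmul 1 1
    simp only [one_mul, left_eq_add] at this
    exact Finsupp.mapDomain_id.symm.trans this
  -- With I the reduced group ring, `G →₀ I` stands for k[G] ⊗ I. The map `π` is the projection to I
  -- ⊗ I, `α` is the augmentation of the left factor, and `α` plus multiplication after `π` is the
  -- action map k[G] ⊗ I → I.
  let π : (G →₀ RedGroupRing k G) →ₗ[k] RedGroupRing k G ⊗[k] RedGroupRing k G :=
    Finsupp.lsum k fun g => TensorProduct.mk k _ _ (of k g)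
  let α : (G →₀ RedGroupRing k G) →ₗ[k] RedGroupRing k G := Finsupp.lsum k fun g => LinearMap.id
  have hπs (g : G) (v) : π (Finsupp.single g v) = of k g ⊗ₜ v := by simp [π]
  have hαs (g : G) (v) : α (Finsupp.single g v) = v := by simp [α]
  have hπ (g : G) (y) : π (Finsupp.mapDomain (g * ·) y) =
      π y + of k g ⊗ₜ α y + (mul (of k g)).rTensor _ (π y) := by
    induction y using Finsupp.induction_linear with
    | zero => simp
    | add y z hy hz =>
      rw [Finsupp.mapDomain_add]
      simp only [map_add, hy, hz, TensorProduct.tmul_add]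
      abel
    | single h v =>
      simp only [Finsupp.mapDomain_single, hπs, hαs, LinearMap.rTensor_tmul, mul_of_of,
        TensorProduct.sub_tmul]
      abel
  have hα (g : G) (y) : α (Finsupp.mapDomain (g * ·) y) = α y := by
    induction y using Finsupp.induction_linear with
    | zero => simp
    | add y z hy hz => rw [Finsupp.mapDomain_add, map_add, map_add, hy, hz]
    | single k v => simp [α, Finsupp.mapDomain_single]
  have hlift (g : G) (t) : TensorProduct.lift mul ((mul (of k g)).rTensor _ t) =
      mul (of k g) (TensorProduct.lift mul t) := by
    induction t using TensorProduct.induction_on with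
    | zero => simp
    | add x y hx hy => simp only [map_add, hx, hy]
    | tmul x y => simp [RedGroupRing.mul_assoc]
  let β : G → RedGroupRing k G := fun g => α (D g) + TensorProduct.lift mul (π (D g))
  have step (x y) (hx : β x = of k x) : β (x * y) = of k x + β y + mul (of k x) (β y) := by
    simp only [← hx]
    simp only [β, hmul, map_add, hπ, hα, hlift, TensorProduct.lift.tmul]
    have := congrArg mul hx
    simp only [β, map_add] at this
    rw [this]
    abel
  -- Fox's fundamental formula: the derivative followed by the action map sends g to its class. So
  -- `D` induces a section of k[G] ⊗ I → I.
  have key (g : G) : β g = of k g := by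
    induction g using isFreeGroup_induction with
    | one => simp [β, hone]
    | gen x => simp [β, hgen, hαs, hπs]
    | mul x y hx hy =>
      rw [step x y hx, hy, mul_of_of]
      abel
    | inv x hx =>
      have h1 := step x x⁻¹ hx
      have h2 : β 1 = 0 := by simp [β, hone]
      rw [mul_inv_cancel, h2] at h1
      -- For the difference c this reads x · c = 0 in terms of the group action; multiplying by x⁻¹
      -- gives c = 0.
      have h3 : (β x⁻¹ - of k x⁻¹) + mul (of k x) (β x⁻¹ - of k x⁻¹) = 0 := by
        have h4 := mul_of_of (k := k) x x⁻¹
        rw [mul_inv_cancel, of_one] at h4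
        refine Eq.trans ?_ h1.symm
        rw [map_sub, h4]
        abel
      rw [← sub_eq_zero]
      generalize β x⁻¹ - of k x⁻¹ = c at h3 ⊢
      have h4 := congrArg (mul (of k x⁻¹)) h3
      rw [map_add, ← RedGroupRing.mul_assoc, mul_of_of, inv_mul_cancel, of_one, map_zero] at h4
      simp only [zero_sub, map_sub, map_neg, LinearMap.sub_apply, LinearMap.neg_apply] at h4
      have h5 : mul (of k x) c = 0 := by
        rw [← neg_eq_zero]
        refine Eq.trans ?_ h4
        abel
      rwa [h5, add_zero] at h3
  refine ⟨lift (fun g => π (D g)) (by simp [hone]), fun b c => ?_⟩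
  induction b using RedGroupRing.induction with
  | add x y hx hy =>
    simp only [map_add, LinearMap.add_apply, hx, hy, LinearMap.rTensor_add, TensorProduct.add_tmul]
    abel
  | smul r x hx =>
    simp only [map_smul, LinearMap.smul_apply, hx, LinearMap.rTensor_smul, TensorProduct.smul_tmul',
      smul_add, smul_sub]
  | of x =>
  induction c using RedGroupRing.induction with
  | add x y hx hy =>
    simp only [map_add, hx, hy, TensorProduct.tmul_add]
    abel
  | smul r x hx =>
    simp only [map_smul, hx, TensorProduct.tmul_smul, smul_add, smul_sub]
  | of y =>
    have hy : of k y = β y := (key y).symm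
    simp only [mul_of_of, map_sub, lift_of, hmul, map_add, hπ]
    rw [hy]
    simp only [β, TensorProduct.tmul_add]
    abel

end Fox

end FunctorsOnFreeGroups

namespace FunctorsOnFreeGroups

/-! ### Contractions of the bar complex of a module. -/

section LoopModule

open RedGroupRing

variable {k : Type} [CommRing k] {G M : Type} [Group G] [AddCommGroup M] [Module k M]

/-- The action of the reduced group ring on the kernel `RedGroupRing k G ⊗ M` of the action map
`k[G] ⊗ M → M`. -/
noncomputable def loopAct (a : RedGroupRing k G →ₗ[k] M →ₗ[k] M) :
    RedGroupRing k G →ₗ[k] RedGroupRing k G ⊗[k] M →ₗ[k] RedGroupRing k G ⊗[k] M :=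
  LinearMap.mk₂ k (fun b t => (mul b).rTensor M t - b ⊗ₜ TensorProduct.lift a t)
    (fun b c t => by
      simp only [map_add, LinearMap.rTensor_add, LinearMap.add_apply, TensorProduct.add_tmul]
      abel)
    (fun r b t => by
      simp only [map_smul, LinearMap.rTensor_smul, LinearMap.smul_apply, TensorProduct.smul_tmul',
        smul_sub])
    (fun b t u => by
      simp only [map_add, TensorProduct.tmul_add]
      abel)
    (fun r b t => by simp only [map_smul, TensorProduct.tmul_smul, smul_sub])

@[simp]
lemma loopAct_tmul (a : RedGroupRing k G →ₗ[k] M →ₗ[k] M) (b c : RedGroupRing k G) (m : M) :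
    loopAct a b (c ⊗ₜ m) = mul b c ⊗ₜ m - b ⊗ₜ a c m := by
  simp [loopAct]

lemma loopAct_loopAct (a : RedGroupRing k G →ₗ[k] M →ₗ[k] M)
    (ha : ∀ b c m, a b (a c m) = a (mul b c) m) (b c : RedGroupRing k G)
    (t : RedGroupRing k G ⊗[k] M) :
    loopAct a b (loopAct a c t) = loopAct a (mul b c) t := by
  induction t using TensorProduct.induction_on with
  | zero => simp
  | add x y hx hy => simp only [map_add, hx, hy]
  | tmul e m => simp [ha, RedGroupRing.mul_assoc]

lemma lift_loopAct (a : RedGroupRing k G →ₗ[k] M →ₗ[k] M)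
    (ha : ∀ b c m, a b (a c m) = a (mul b c) m)
    (t : RedGroupRing k G ⊗[k] (RedGroupRing k G ⊗[k] M)) :
    TensorProduct.lift a (TensorProduct.lift (loopAct a) t) = 0 := by
  have : TensorProduct.lift a ∘ₗ TensorProduct.lift (loopAct a) = 0 :=
    TensorProduct.ext' fun b t => by
      induction t using TensorProduct.induction_on with
      | zero => simp
      | add x y hx hy => simp only [TensorProduct.tmul_add, map_add, hx, hy]
      | tmul e m => simp [ha]
  exact LinearMap.congr_fun this t

/-- A `k`-linear contraction of the bar complex of a module over the reduced group ring. -/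
def IsContraction (a : RedGroupRing k G →ₗ[k] M →ₗ[k] M) (s : M →ₗ[k] RedGroupRing k G ⊗[k] M) :
    Prop :=
  ∀ b m, s (a b m) = loopAct a b (s m) + b ⊗ₜ m

/-- For an associative action, a contraction amounts to a k[G]-linear section m ↦ 1 ⊗ m + s m of
k[G] ⊗ M → M, with I ⊗ M embedded by c ⊗ m ↦ c ⊗ m - 1 ⊗ cm. The sign here compensates for the minus
sign in `loopAct`. -/
lemma IsContraction.loopAct {a : RedGroupRing k G →ₗ[k] M →ₗ[k] M}
    {s : M →ₗ[k] RedGroupRing k G ⊗[k] M} (h : IsContraction a s) :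
    IsContraction (loopAct a) (-s.lTensor (RedGroupRing k G)) := by
  intro b t
  induction t using TensorProduct.induction_on with
  | zero => simp
  | add x y hx hy =>
    simp only [map_add, hx, hy, TensorProduct.tmul_add]
    abel
  | tmul e m =>
    have := h e m
    simp only [loopAct_tmul, map_sub, LinearMap.neg_apply, LinearMap.lTensor_tmul, map_neg, this,
      TensorProduct.tmul_add]
    abel

/-- The homotopy identity is s ∘ d = d ∘ (1 ⊗ s) + id, so a cycle t is the boundary of -(1 ⊗ s) t.
-/
lemma IsContraction.exact {a : RedGroupRing k G →ₗ[k] M →ₗ[k] M}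
    (ha : ∀ b c m, a b (a c m) = a (mul b c) m)
    {s : M →ₗ[k] RedGroupRing k G ⊗[k] M} (h : IsContraction a s) :
    Function.Exact (TensorProduct.lift (FunctorsOnFreeGroups.loopAct a))
      (TensorProduct.lift a) := by
  intro t
  constructor
  · intro ht
    have key (t) : s (TensorProduct.lift a t) =
        TensorProduct.lift (FunctorsOnFreeGroups.loopAct a) (s.lTensor _ t) + t := by
      induction t using TensorProduct.induction_on with
      | zero => simp
      | add x y hx hy =>
        simp only [map_add, hx, hy]
        abel
      | tmul e m => simp [h e m]
    have h2 := key t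
    rw [ht, map_zero] at h2
    exact ⟨-s.lTensor _ t, by rw [map_neg, neg_eq_of_add_eq_zero_right h2.symm]⟩
  · rintro ⟨t, rfl⟩
    exact lift_loopAct a ha t

/-- When M has zero action, I acts on I ⊗ M through the left factor alone, so the contraction of I
can be tensored with M. Freeness of G enters the bar resolution here. -/
lemma exists_isContraction_loopAct_zero [IsFreeGroup G] :
    ∃ s, IsContraction (loopAct (0 : RedGroupRing k G →ₗ[k] M →ₗ[k] M)) s := by
  obtain ⟨s, hs⟩ := exists_contraction (k := k) (G := G)
  refine ⟨(TensorProduct.assoc k _ _ _).toLinearMap ∘ₗ s.rTensor M, fun b t => ?_⟩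
  induction t using TensorProduct.induction_on with
  | zero => simp
  | add x y hx hy =>
    simp only [map_add, hx, hy, TensorProduct.tmul_add]
    abel
  | tmul e m =>
    have key (t : RedGroupRing k G ⊗[k] RedGroupRing k G) :
        loopAct (loopAct 0) b (TensorProduct.assoc k _ _ _ (t ⊗ₜ m)) =
          TensorProduct.assoc k _ _ _ ((mul b).rTensor _ t ⊗ₜ m) -
            b ⊗ₜ (TensorProduct.lift mul t ⊗ₜ m) := by
      induction t using TensorProduct.induction_on with
      | zero => simp
      | add x y hx hy =>
        simp only [map_add, TensorProduct.add_tmul, TensorProduct.tmul_add, hx, hy]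
        abel
      | tmul u v => simp
    simp [hs, key, TensorProduct.add_tmul, TensorProduct.sub_tmul]

end LoopModule

/-! ### Functors on free groups and their pointwise tensor products. -/

section Functors

variable {k : Type} [CommRing k]

variable (k) in
/-- Functors from finitely generated free groups to `k`-modules. -/
abbrev Fun (k : Type) [CommRing k] : Type 1 := Gr ⥤ ModuleCat.{0} k

/-- A natural transformation from a natural family of linear maps. -/
def natTransOfLinear {X Y : Fun k} (a : ∀ G, X.obj G →ₗ[k] Y.obj G)
    (ha : ∀ ⦃G H⦄ (f : G ⟶ H) x, a H ((X.map f).hom x) = (Y.map f).hom (a G x)) : X ⟶ Y where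
  app G := ModuleCat.ofHom (a G)
  naturality _ _ f := ModuleCat.hom_ext (LinearMap.ext fun x => ha f x)

lemma natTrans_map {X Y : Fun k} (φ : X ⟶ Y) {G H : Gr} (f : G ⟶ H) (x : X.obj G) :
    (φ.app H).hom ((X.map f).hom x) = (Y.map f).hom ((φ.app G).hom x) :=
  LinearMap.congr_fun (congrArg ModuleCat.Hom.hom (φ.naturality f)) x

lemma natTrans_ext {X Y : Fun k} {φ ψ : X ⟶ Y}
    (h : ∀ G x, (φ.app G).hom x = (ψ.app G).hom x) : φ = ψ := by
  ext G x
  exact h G x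

lemma fun_map_id (X : Fun k) (G : Gr) (x : X.obj G) : (X.map (𝟙 G)).hom x = x := by simp

lemma fun_map_comp (X : Fun k) {G H K : Gr} (f : G ⟶ H) (g : H ⟶ K) (x : X.obj G) :
    (X.map (f ≫ g)).hom x = (X.map g).hom ((X.map f).hom x) := by simp

/-- A natural isomorphism from a natural family of linear equivalences. -/
def natIsoOfLinear {X Y : Fun k} (a : ∀ G, X.obj G ≃ₗ[k] Y.obj G)
    (ha : ∀ ⦃G H⦄ (f : G ⟶ H) x, a H ((X.map f).hom x) = (Y.map f).hom (a G x)) : X ≅ Y :=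
  NatIso.ofComponents (fun G => (a G).toModuleIso)
    fun {_ _} f => ModuleCat.hom_ext (LinearMap.ext fun x => ha f x)

/-- The pointwise tensor product of functors. -/
noncomputable def tens (X Y : Fun k) : Fun k where
  obj G := ModuleCat.of k (X.obj G ⊗[k] Y.obj G)
  map f := ModuleCat.ofHom (TensorProduct.map (X.map f).hom (Y.map f).hom)
  map_id G := by
    apply ModuleCat.hom_ext
    simp
  map_comp f g := by
    apply ModuleCat.hom_ext
    simp [TensorProduct.map_comp]

/-- Elementary tensors in `tens X Y`. -/
noncomputable def tm {X Y : Fun k} {G : Gr} :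
    X.obj G →ₗ[k] Y.obj G →ₗ[k] (tens X Y).obj G :=
  TensorProduct.mk k (X.obj G) (Y.obj G)

lemma tens_map {X Y : Fun k} {G H : Gr} (f : G ⟶ H) (x : X.obj G) (y : Y.obj G) :
    ((tens X Y).map f).hom (tm x y) = tm ((X.map f).hom x) ((Y.map f).hom y) := rfl

lemma tens_natTrans_ext {X Y Z : Fun k} {φ ψ : tens X Y ⟶ Z}
    (h : ∀ G x y, (φ.app G).hom (tm x y) = (ψ.app G).hom (tm x y)) : φ = ψ :=
  natTrans_ext fun G t => LinearMap.congr_fun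
    (f := ((φ.app G).hom : X.obj G ⊗[k] Y.obj G →ₗ[k] Z.obj G)) (TensorProduct.ext' (h G)) t

/-- A natural transformation out of a tensor product from a natural family of bilinear maps. -/
noncomputable def tensDesc {X Y Z : Fun k} (a : ∀ G, X.obj G →ₗ[k] Y.obj G →ₗ[k] Z.obj G)
    (ha : ∀ ⦃G H⦄ (f : G ⟶ H) x y,
      a H ((X.map f).hom x) ((Y.map f).hom y) = (Z.map f).hom (a G x y)) : tens X Y ⟶ Z :=
  natTransOfLinear (X := tens X Y) (fun G => TensorProduct.lift (a G)) fun G H f t => by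
    refine LinearMap.congr_fun (f := TensorProduct.lift (a H) ∘ₗ
      TensorProduct.map (X.map f).hom (Y.map f).hom)
      (g := (Z.map f).hom ∘ₗ TensorProduct.lift (a G)) (TensorProduct.ext' fun x y => ?_) t
    simpa using ha f x y

lemma tensDesc_tm {X Y Z : Fun k} (a : ∀ G, X.obj G →ₗ[k] Y.obj G →ₗ[k] Z.obj G)
    (ha : ∀ ⦃G H⦄ (f : G ⟶ H) x y,
      a H ((X.map f).hom x) ((Y.map f).hom y) = (Z.map f).hom (a G x y)) {G : Gr} (x : X.obj G)
    (y : Y.obj G) : ((tensDesc a ha).app G).hom (tm x y) = a G x y :=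
  TensorProduct.lift.tmul _ _

/-- Functoriality of the pointwise tensor product for isomorphisms. -/
noncomputable def tensIso {X X' Y Y' : Fun k} (e : X ≅ X') (e' : Y ≅ Y') : tens X Y ≅ tens X' Y' :=
  natIsoOfLinear (X := tens X Y) (Y := tens X' Y')
    (fun G => TensorProduct.congr (e.app G).toLinearEquiv (e'.app G).toLinearEquiv)
    fun G H f t => by
    refine LinearMap.congr_fun (f := TensorProduct.map (e.hom.app H).hom (e'.hom.app H).hom ∘ₗ
      TensorProduct.map (X.map f).hom (Y.map f).hom)
      (g := TensorProduct.map (X'.map f).hom (Y'.map f).hom ∘ₗ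
        TensorProduct.map (e.hom.app G).hom (e'.hom.app G).hom)
      (TensorProduct.ext' fun x y => ?_) t
    simp

/-- The pointwise tensor product is symmetric. -/
noncomputable def tensLeftComm (X Y Z : Fun k) : tens X (tens Y Z) ≅ tens Y (tens X Z) :=
  natIsoOfLinear (X := tens X (tens Y Z)) (Y := tens Y (tens X Z))
    (fun G => TensorProduct.leftComm k (X.obj G) (Y.obj G) (Z.obj G)) fun G H f t => by
    refine LinearMap.congr_fun
      (f := (TensorProduct.leftComm k (X.obj H) (Y.obj H) (Z.obj H)).toLinearMap ∘ₗ
        TensorProduct.map (X.map f).hom (TensorProduct.map (Y.map f).hom (Z.map f).hom))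
      (g := TensorProduct.map (Y.map f).hom (TensorProduct.map (X.map f).hom (Z.map f).hom) ∘ₗ
        (TensorProduct.leftComm k (X.obj G) (Y.obj G) (Z.obj G)).toLinearMap)
      (TensorProduct.ext (LinearMap.ext fun x => TensorProduct.ext' fun y z => ?_)) t
    simp

lemma exact_of_pointwise (S : ShortComplex (Fun k))
    (h : ∀ G, Function.Exact (S.f.app G).hom (S.g.app G).hom) : S.Exact := by
  rw [ShortComplex.exact_iff_isZero_homology, Functor.isZero_iff]
  intro G
  refine Limits.IsZero.of_iso ?_ (S.mapHomologyIso ((evaluation _ _).obj G)).symm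
  rw [← ShortComplex.exact_iff_isZero_homology,
    ShortComplex.ShortExact.moduleCat_exact_iff_function_exact]
  exact h G

lemma epi_of_pointwise {X Y : Fun k} (φ : X ⟶ Y)
    (h : ∀ G, Function.Surjective (φ.app G).hom) : Epi φ := by
  rw [NatTrans.epi_iff_epi_app]
  intro G
  exact (ModuleCat.epi_iff_surjective _).2 (h G)

lemma surjective_of_epi {X Y : Fun k} (φ : X ⟶ Y) [Epi φ] (G : Gr) :
    Function.Surjective (φ.app G).hom :=
  (ModuleCat.epi_iff_surjective _).1 inferInstance

end Functors

/-! ### The bar resolution of 𝔞 ⊗ W. -/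

section Bar

open RedGroupRing

variable {k : Type} [CommRing k]

variable (k) in
/-- The reduced group ring as a functor. -/
noncomputable def redGroupRing : Fun k where
  obj G := ModuleCat.of k (RedGroupRing k G.obj)
  map f := ModuleCat.ofHom (RedGroupRing.map k f.hom.hom)
  map_id G := ModuleCat.hom_ext (RedGroupRing.hom_ext fun x => by simp)
  map_comp f g := ModuleCat.hom_ext (RedGroupRing.hom_ext fun x => by simp)

/-- A functor with a natural action of the reduced group ring. -/
structure RedModule (k : Type) [CommRing k] where
  /-- the underlying functor -/
  carrier : Fun k
  /-- the action -/
  act (G : Gr) : RedGroupRing k G.obj →ₗ[k] carrier.obj G →ₗ[k] carrier.obj G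
  act_act (G : Gr) (b c : RedGroupRing k G.obj) (m) : act G b (act G c m) = act G (mul b c) m
  act_map {G H : Gr} (f : G ⟶ H) (b : RedGroupRing k G.obj) (m) :
    act H (RedGroupRing.map k f.hom.hom b) ((carrier.map f).hom m) = (carrier.map f).hom (act G b m)

namespace RedModule

/-- The trivial action. -/
noncomputable def trivial (W : Fun k) : RedModule k where
  carrier := W
  act G := 0
  act_act := by simp
  act_map := by simp

/-- The kernel of the action map of the group ring. -/
noncomputable def loop (M : RedModule k) : RedModule k where
  carrier := tens (redGroupRing k) M.carrier
  act G := loopAct (M.act G)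
  act_act G := loopAct_loopAct _ (M.act_act G)
  act_map {G H} f b t := by
    refine LinearMap.congr_fun (f := loopAct (M.act H) (RedGroupRing.map k f.hom.hom b) ∘ₗ
      TensorProduct.map (RedGroupRing.map k f.hom.hom) (M.carrier.map f).hom)
      (g := TensorProduct.map (RedGroupRing.map k f.hom.hom) (M.carrier.map f).hom ∘ₗ
        loopAct (M.act G) b) (TensorProduct.ext' fun x y => ?_) t
    simp [RedGroupRing.map_mul, M.act_map]

/-- The action map as a natural transformation. -/
noncomputable def actHom (M : RedModule k) : M.loop.carrier ⟶ M.carrier :=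
  tensDesc (X := redGroupRing k) M.act fun _ _ => M.act_map

/-- The terms of the bar complex. -/
noncomputable def bar (W : Fun k) : ℕ → RedModule k
  | 0 => trivial W
  | n + 1 => (bar W n).loop

/-- The index starts at 1 because the trivial module is in general not contractible; that defect is
what leaves I/I² ⊗ W at the end of the complex. -/
lemma exists_isContraction_bar (W : Fun k) (n : ℕ) (G : Gr) :
    ∃ s, IsContraction ((bar W (n + 1)).act G) s := by
  induction n with
  | zero =>
    have := G.property.1
    exact exists_isContraction_loopAct_zero
  | succ n ih =>
    obtain ⟨s, hs⟩ := ih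
    exact ⟨_, hs.loopAct⟩

lemma exact_bar (W : Fun k) (n : ℕ) (G : Gr) :
    Function.Exact ((bar W (n + 1)).loop.actHom.app G).hom ((bar W (n + 1)).actHom.app G).hom := by
  obtain ⟨s, hs⟩ := exists_isContraction_bar W n G
  exact hs.exact ((bar W (n + 1)).act_act G)

end RedModule

variable (k) in
/-- The linear abelianization functor `I/I²`, where `I` is the augmentation ideal. -/
noncomputable def indec : Fun k where
  obj G := ModuleCat.of k (RedGroupRing k G.obj ⧸
    LinearMap.range (TensorProduct.lift (mul (k := k) (G := G.obj))))
  map {G H} f := ModuleCat.ofHom (Submodule.mapQ _ _ (RedGroupRing.map k f.hom.hom) (by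
    rintro _ ⟨t, rfl⟩
    refine ⟨TensorProduct.map (RedGroupRing.map k f.hom.hom) (RedGroupRing.map k f.hom.hom) t, ?_⟩
    refine LinearMap.congr_fun (f := TensorProduct.lift mul ∘ₗ TensorProduct.map _ _)
      (g := RedGroupRing.map k f.hom.hom ∘ₗ TensorProduct.lift mul)
      (TensorProduct.ext' fun x y => ?_) t
    simp [RedGroupRing.map_mul]))
  map_id G := ModuleCat.hom_ext (Submodule.linearMap_qext _ (RedGroupRing.hom_ext fun x => by simp))
  map_comp f g := ModuleCat.hom_ext
    (Submodule.linearMap_qext _ (RedGroupRing.hom_ext fun x => by simp))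

/-- The projection `I → I/I²`. -/
noncomputable def toIndec (G : Gr) : RedGroupRing k G.obj →ₗ[k] (indec k).obj G :=
  Submodule.mkQ (LinearMap.range (TensorProduct.lift (mul (k := k) (G := G.obj))))

lemma toIndec_surjective (G : Gr) : Function.Surjective (toIndec (k := k) G) :=
  Submodule.mkQ_surjective _

lemma exact_toIndec (G : Gr) :
    Function.Exact (TensorProduct.lift (mul (k := k) (G := G.obj))) (toIndec (k := k) G) :=
  LinearMap.exact_map_mkQ_range _

lemma toIndec_of_mul (G : Gr) (g h : G.obj) :
    toIndec (k := k) G (of k (g * h)) = toIndec G (of k g) + toIndec G (of k h) := by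
  have := (exact_toIndec (k := k) G (mul (of k g) (of k h))).2 ⟨of k g ⊗ₜ of k h, by simp⟩
  rw [mul_of_of, map_sub, map_sub, sub_sub, sub_eq_zero] at this
  exact this

/-- The augmentation of the bar complex. -/
noncomputable def barAug (W : Fun k) : tens (redGroupRing k) W ⟶ tens (indec k) W :=
  tensDesc (X := redGroupRing k)
    (fun G => TensorProduct.mk k ((indec k).obj G) (W.obj G) ∘ₗ toIndec G)
    fun _ _ _ _ _ => rfl

open RedModule in
/-- The bar complex resolves the linear abelianization functor tensored with any functor. -/
lemma isLeftResolution_bar (W : Fun k) :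
    IsLeftResolution (fun n => (bar W (n + 1)).carrier) (fun n => (bar W (n + 1)).actHom)
      (barAug W) := by
  have hε (G : Gr) : (barAug W).app G = ModuleCat.ofHom ((toIndec G).rTensor (W.obj G)) :=
    ModuleCat.hom_ext (TensorProduct.ext' fun x y => rfl)
  have hd (G : Gr) : ((bar W 1).actHom.app G).hom =
      (TensorProduct.lift (mul (k := k) (G := G.obj))).rTensor (W.obj G) ∘ₗ
        (TensorProduct.assoc k (RedGroupRing k G.obj) (RedGroupRing k G.obj)
          (W.obj G)).symm.toLinearMap := by
    refine TensorProduct.ext (LinearMap.ext fun x => TensorProduct.ext' fun y z => ?_)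
    have (x y : RedGroupRing k G.obj) (z : W.obj G) :
        loopAct 0 x (y ⊗ₜ z) = mul x y ⊗ₜ[k] z := by simp
    exact this x y z
  -- The end of the complex is I ⊗ I → I → I/I² → 0 tensored with W, exact by right exactness of the
  -- tensor product; the other places are covered by `exact_bar`.
  have h0 (G : Gr) : Function.Exact ((bar W 1).actHom.app G).hom ((barAug W).app G).hom := by
    rw [hd, hε]
    intro x
    refine (rTensor_exact (W.obj G) (exact_toIndec (k := k) G) (toIndec_surjective G) x).trans ?_
    exact (Set.ext_iff.1 ((TensorProduct.assoc k (RedGroupRing k G.obj) (RedGroupRing k G.obj)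
      (W.obj G)).symm.surjective.range_comp
        ((TensorProduct.lift (mul (k := k) (G := G.obj))).rTensor (W.obj G))) x).symm
  have hc0 : (bar W 1).actHom ≫ barAug W = 0 := natTrans_ext fun G x => (h0 G).apply_apply_eq_zero x
  have hc (n) : (bar W (n + 2)).actHom ≫ (bar W (n + 1)).actHom = 0 :=
    natTrans_ext fun G x => (exact_bar W n G).apply_apply_eq_zero x
  exact
    { epi := epi_of_pointwise _ fun G => by
        rw [hε]
        exact LinearMap.rTensor_surjective _ (toIndec_surjective G)
      comp_zero := hc0
      exact_zero := exact_of_pointwise _ h0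
      comp := hc
      exact := fun n => exact_of_pointwise _ (exact_bar W n) }

end Bar

end FunctorsOnFreeGroups

namespace FunctorsOnFreeGroups

/-! ### Adjoining a free generator to a group. -/

section Coproduct

lemma isFreeGroup_coprod (G H : Type) [Group G] [Group H] [IsFreeGroup G] [IsFreeGroup H] :
    IsFreeGroup (Monoid.Coprod G H) := by
  refine IsFreeGroup.ofUniqueLift (IsFreeGroup.Generators G ⊕ IsFreeGroup.Generators H)
    (Sum.elim (fun x => Monoid.Coprod.inl (IsFreeGroup.of x))
      fun x => Monoid.Coprod.inr (IsFreeGroup.of x)) fun {K} _ f => ?_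
  refine ⟨Monoid.Coprod.lift (IsFreeGroup.lift (f ∘ Sum.inl)) (IsFreeGroup.lift (f ∘ Sum.inr)),
    ?_, fun F hF => ?_⟩
  · rintro (x | x) <;> simp
  · refine Monoid.Coprod.hom_ext (IsFreeGroup.ext_hom fun x => ?_) (IsFreeGroup.ext_hom fun x => ?_)
    · simpa using hF (Sum.inl x)
    · simpa using hF (Sum.inr x)

lemma fg_coprod (G H : Type) [Group G] [Group H] [Group.FG G] [Group.FG H] :
    Group.FG (Monoid.Coprod G H) := by
  rw [Group.fg_def, ← Monoid.Coprod.range_inl_sup_range_inr]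
  exact ((Group.fg_iff_subgroup_fg _).1 inferInstance).sup
    ((Group.fg_iff_subgroup_fg _).1 inferInstance)

/-- A morphism of `gr` from a group homomorphism. -/
def grHom {G H : Gr} (f : G.obj →* H.obj) : G ⟶ H := ⟨GrpCat.ofHom f⟩

lemma gr_hom_ext {G H : Gr} {f g : G ⟶ H} (h : f.hom.hom = g.hom.hom) : f = g :=
  ObjectProperty.hom_ext _ (GrpCat.hom_ext h)

/-- The free product with an infinite cyclic group, on objects. -/
noncomputable def adjoinObj (G : Gr) : Gr :=
  ⟨GrpCat.of (Monoid.Coprod G.obj (FreeGroup Unit)), by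
    have := G.property.1
    have := G.property.2
    exact ⟨isFreeGroup_coprod _ _, fg_coprod _ _⟩⟩

/-- The free product with an infinite cyclic group. -/
noncomputable def adjoin : Gr ⥤ Gr where
  obj := adjoinObj
  map {_ _} f := grHom (G := adjoinObj _) (H := adjoinObj _)
    (Monoid.Coprod.map f.hom.hom (MonoidHom.id (FreeGroup Unit)))
  map_id _ := gr_hom_ext Monoid.Coprod.map_id_id
  map_comp _ _ := gr_hom_ext (Monoid.Coprod.hom_ext rfl rfl)

/-- The new generator. -/
noncomputable def newGen (G : Gr) : (adjoin.obj G).obj :=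
  (Monoid.Coprod.inr (FreeGroup.of ()) : Monoid.Coprod G.obj (FreeGroup Unit))

/-- The inclusion of the old group. -/
noncomputable def incl (G : Gr) : G ⟶ adjoin.obj G :=
  grHom (H := adjoinObj G) (Monoid.Coprod.inl : G.obj →* Monoid.Coprod G.obj (FreeGroup Unit))

/-- The retraction sending the new generator to `g`. -/
noncomputable def specialize {G : Gr} (g : G.obj) : adjoin.obj G ⟶ G :=
  grHom (G := adjoinObj G)
    (Monoid.Coprod.lift (MonoidHom.id G.obj) (FreeGroup.lift fun _ : Unit => g))

lemma specialize_newGen {G : Gr} (g : G.obj) : (specialize g).hom.hom (newGen G) = g :=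
  (Monoid.Coprod.lift_apply_inr _ _ _).trans (by simp)

lemma adjoin_map_newGen {G H : Gr} (f : G ⟶ H) :
    (adjoin.map f).hom.hom (newGen G) = newGen H :=
  Monoid.Coprod.map_apply_inr _ _ _

lemma incl_specialize {G : Gr} (g : G.obj) : incl G ≫ specialize g = 𝟙 G :=
  gr_hom_ext (MonoidHom.ext fun x => by
    exact Monoid.Coprod.lift_apply_inl (MonoidHom.id G.obj) (FreeGroup.lift fun _ : Unit => g) x)

lemma incl_adjoin_map {G H : Gr} (f : G ⟶ H) : incl G ≫ adjoin.map f = f ≫ incl H :=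
  gr_hom_ext (MonoidHom.ext fun x => Monoid.Coprod.map_apply_inl _ _ x)

lemma adjoin_hom_ext {G : Gr} {K : Type} [Group K] {f g : (adjoin.obj G).obj →* K}
    (h₁ : ∀ x, f ((incl G).hom.hom x) = g ((incl G).hom.hom x))
    (h₂ : f (newGen G) = g (newGen G)) : f = g :=
  Monoid.Coprod.hom_ext (M := G.obj) (N := FreeGroup Unit) (MonoidHom.ext h₁)
    (FreeGroup.ext_hom _ _ fun _ => h₂)

lemma adjoin_map_specialize {G H : Gr} (f : G ⟶ H) (g : G.obj) :
    adjoin.map f ≫ specialize (f.hom.hom g) = specialize g ≫ f := by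
  refine gr_hom_ext (adjoin_hom_ext (fun x => ?_) ?_)
  · refine DFunLike.congr_fun (congrArg (fun φ => φ.hom.hom)
      (?_ : incl G ≫ adjoin.map f ≫ specialize (f.hom.hom g) = incl G ≫ specialize g ≫ f)) x
    rw [← Category.assoc, incl_adjoin_map, Category.assoc, incl_specialize, Category.comp_id,
      ← Category.assoc, incl_specialize, Category.id_comp]
  · simp [adjoin_map_newGen, specialize_newGen]

end Coproduct

/-! ### Universal elements and projectivity. -/

section Projective

open RedGroupRing

variable {k : Type} [CommRing k]

variable (k) in
/-- The class of `g` in the reduced group ring functor. -/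
noncomputable def gen {G : Gr} (g : G.obj) : (redGroupRing k).obj G := of k g

@[simp]
lemma gen_one {G : Gr} : gen k (1 : G.obj) = 0 := of_one

lemma redGroupRing_map_gen {G H : Gr} (f : G ⟶ H) (g : G.obj) :
    ((redGroupRing k).map f).hom (gen k g) = gen k (f.hom.hom g) := RedGroupRing.map_of _ _

lemma redGroupRing_hom_ext {G : Gr} {A : Type} [AddCommGroup A] [Module k A]
    {φ ψ : (redGroupRing k).obj G →ₗ[k] A} (h : ∀ g, φ (gen k g) = ψ (gen k g)) : φ = ψ :=
  RedGroupRing.hom_ext h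

lemma tens_redGroupRing_ext {X F : Fun k} {φ ψ : tens (redGroupRing k) X ⟶ F}
    (h : ∀ (G : Gr) (g : G.obj) x, (φ.app G).hom (tm (gen k g) x) =
      (ψ.app G).hom (tm (gen k g) x)) : φ = ψ := by
  refine tens_natTrans_ext fun G b x => ?_
  have : (φ.app G).hom ∘ₗ tm.flip x = (ψ.app G).hom ∘ₗ tm.flip x :=
    redGroupRing_hom_ext fun g => h G g x
  exact LinearMap.congr_fun this b

/-- The value of a natural transformation on the universal element. -/
noncomputable def universalValue {X F : Fun k} (φ : tens (redGroupRing k) X ⟶ F) :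
    X ⟶ adjoin ⋙ F :=
  natTransOfLinear (fun G => ((φ.app (adjoin.obj G)).hom ∘ₗ tm (gen k (newGen G))) ∘ₗ
      (X.map (incl G)).hom) fun G H f x => by
    refine Eq.trans ?_ (natTrans_map φ (adjoin.map f)
      (tm (gen k (newGen G)) ((X.map (incl G)).hom x)))
    rw [tens_map, redGroupRing_map_gen, adjoin_map_newGen, ← fun_map_comp, incl_adjoin_map,
      fun_map_comp]
    rfl

lemma universalValue_app {X F : Fun k} (φ : tens (redGroupRing k) X ⟶ F) (G : Gr) (x : X.obj G) :
    ((universalValue φ).app G).hom x = (φ.app (adjoin.obj G)).hom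
      (tm (gen k (newGen G)) ((X.map (incl G)).hom x)) := rfl

/-- Each tensor [g] ⊗ x is the image under `specialize g` of the tensor of x with the class of the
new generator, so the universal value determines `φ`. -/
lemma map_specialize_universalValue {X F : Fun k} (φ : tens (redGroupRing k) X ⟶ F) (G : Gr)
    (g : G.obj) (x : X.obj G) :
    (F.map (specialize g)).hom (((universalValue φ).app G).hom x) =
      (φ.app G).hom (tm (gen k g) x) := by
  rw [universalValue_app, ← natTrans_map, tens_map, redGroupRing_map_gen, specialize_newGen,
    ← fun_map_comp, incl_specialize, fun_map_id]

lemma map_specialize_one_universalValue {X F : Fun k} (φ : tens (redGroupRing k) X ⟶ F) (G : Gr)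
    (x : X.obj G) :
    (F.map (specialize (1 : G.obj))).hom (((universalValue φ).app G).hom x) = 0 := by
  rw [map_specialize_universalValue, gen_one, map_zero, LinearMap.zero_apply, map_zero]

/-- The components of the natural transformation with given value on the universal element. -/
noncomputable def evalUniversalValue {X F : Fun k} (l : X ⟶ adjoin ⋙ F) (G : Gr) :
    (redGroupRing k).obj G →ₗ[k] X.obj G →ₗ[k] F.obj G :=
  RedGroupRing.lift
    -- Subtracting the term at 1 lets the formula descend to the reduced group ring for every `l`;
    -- it changes nothing when `l` is already killed by `specialize 1`.
    (fun g => ((F.map (specialize g)).hom - (F.map (specialize 1)).hom) ∘ₗ (l.app G).hom) (by simp)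

lemma evalUniversalValue_gen {X F : Fun k} (l : X ⟶ adjoin ⋙ F) (G : Gr) (g : G.obj)
    (x : X.obj G) : evalUniversalValue l G (gen k g) x =
      (F.map (specialize g)).hom ((l.app G).hom x) -
        (F.map (specialize 1)).hom ((l.app G).hom x) :=
  LinearMap.congr_fun (RedGroupRing.lift_of _ _ _) x

lemma evalUniversalValue_map {X F : Fun k} (l : X ⟶ adjoin ⋙ F) ⦃G H : Gr⦄ (f : G ⟶ H)
    (b : (redGroupRing k).obj G) (x : X.obj G) :
    evalUniversalValue l H (((redGroupRing k).map f).hom b) ((X.map f).hom x) =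
      (F.map f).hom (evalUniversalValue l G b x) := by
  have key (g : G.obj) : (F.map (specialize (f.hom.hom g))).hom
      ((l.app H).hom ((X.map f).hom x)) =
      (F.map f).hom ((F.map (specialize g)).hom ((l.app G).hom x)) := by
    rw [natTrans_map, ← fun_map_comp, ← adjoin_map_specialize, fun_map_comp]
    rfl
  have h1 := key 1
  rw [map_one] at h1
  have : (evalUniversalValue l H).flip ((X.map f).hom x) ∘ₗ ((redGroupRing k).map f).hom =
      (F.map f).hom ∘ₗ (evalUniversalValue l G).flip x := redGroupRing_hom_ext fun g => by
    rw [LinearMap.comp_apply, redGroupRing_map_gen, LinearMap.flip_apply, evalUniversalValue_gen,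
      LinearMap.comp_apply, LinearMap.flip_apply, evalUniversalValue_gen, key, h1, map_sub]
  exact LinearMap.congr_fun this b

/-- The natural transformation with given value on the universal element. -/
noncomputable def ofUniversalValue {X F : Fun k} (l : X ⟶ adjoin ⋙ F) :
    tens (redGroupRing k) X ⟶ F :=
  tensDesc (evalUniversalValue l) (evalUniversalValue_map l)

lemma ofUniversalValue_app {X F : Fun k} (l : X ⟶ adjoin ⋙ F) (G : Gr) (g : G.obj) (x : X.obj G) :
    ((ofUniversalValue l).app G).hom (tm (gen k g) x) =
      (F.map (specialize g)).hom ((l.app G).hom x) -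
        (F.map (specialize 1)).hom ((l.app G).hom x) :=
  (tensDesc_tm _ (evalUniversalValue_map l) _ _).trans (evalUniversalValue_gen l G g x)

/-- Precomposition with `adjoin` preserves epimorphisms, so a universal value lifts by projectivity
of X. The lift need not be killed by `specialize 1`; the subtraction in `ofUniversalValue` repairs
this. -/
instance projective_tens (X : Fun k) [Projective X] : Projective (tens (redGroupRing k) X) where
  factors {E F} φ e he := by
    have : Epi (Functor.whiskerLeft adjoin e) :=
      epi_of_pointwise _ fun G => surjective_of_epi e _
    obtain ⟨l, hl⟩ := Projective.factors (universalValue φ) (Functor.whiskerLeft adjoin e)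
    have hl' (G : Gr) (x : X.obj G) : (e.app (adjoin.obj G)).hom ((l.app G).hom x) =
        ((universalValue φ).app G).hom x := by
      rw [← hl]
      rfl
    refine ⟨ofUniversalValue l, tens_redGroupRing_ext fun G g x => ?_⟩
    refine (congrArg (e.app G).hom (ofUniversalValue_app l G g x)).trans ?_
    rw [map_sub, natTrans_map, natTrans_map, hl', map_specialize_one_universalValue,
      map_specialize_universalValue, sub_zero]

/-- The trivial group, as an initial object of `gr`. -/
def triv : Gr := ⟨GrpCat.of (FreeGroup Empty), inferInstance, inferInstance⟩

/-- The unique morphism from the trivial group. -/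
def fromTriv (G : Gr) : triv ⟶ G := grHom (G := triv) (FreeGroup.lift (α := Empty) Empty.elim)

lemma fromTriv_unique {G : Gr} (f : triv ⟶ G) : f = fromTriv G :=
  gr_hom_ext (FreeGroup.ext_hom (α := Empty) _ _ fun x => x.elim)

variable (k) in
/-- The constant functor with value `k`. -/
def unit : Fun k := (Functor.const Gr).obj (ModuleCat.of k k)

lemma unit_hom_apply {F : Fun k} (φ : unit k ⟶ F) (G : Gr) (r : k) :
    (φ.app G).hom r = r • (F.map (fromTriv G)).hom ((φ.app triv).hom (1 : k)) :=
  (congrArg (φ.app G).hom (mul_one r).symm).trans ((map_smul (φ.app G).hom r (1 : k)).trans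
    (congrArg (r • ·) (natTrans_map φ (fromTriv G) (1 : k))))

/-- Natural transformations out of the constant functor are elements at the trivial group. -/
noncomputable def unitHomEquiv (F : Fun k) : (unit k ⟶ F) ≃+ F.obj triv where
  toFun φ := (φ.app triv).hom (1 : k)
  invFun x := natTransOfLinear (X := unit k)
    (fun G => LinearMap.toSpanSingleton k (F.obj G) ((F.map (fromTriv G)).hom x))
    fun G H f (r : k) => by
      rw [← fromTriv_unique (fromTriv G ≫ f), fun_map_comp]
      exact (map_smul (F.map f).hom r _).symm
  left_inv φ := natTrans_ext fun G (r : k) => (unit_hom_apply φ G r).symm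
  right_inv x := by
    change (1 : k) • (F.map (fromTriv triv)).hom x = x
    rw [one_smul, ← fromTriv_unique (𝟙 triv), fun_map_id]
  map_add' φ ψ := rfl

/-- Maps out of the constant functor are evaluation at the trivial group, and evaluation preserves
epimorphisms. -/
instance projective_unit : Projective (unit k) where
  factors {E F} φ e he := by
    obtain ⟨y, hy⟩ := surjective_of_epi e triv (unitHomEquiv _ φ)
    refine ⟨(unitHomEquiv _).symm y, (unitHomEquiv F).injective ?_⟩
    rw [← hy]
    exact congrArg (e.app triv).hom ((unitHomEquiv E).apply_symm_apply y)

end Projective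

end FunctorsOnFreeGroups

namespace FunctorsOnFreeGroups

/-! ### Exterior powers of a module with a split line. -/

section Exterior

variable {k A B : Type} [CommRing k] [AddCommGroup A] [Module k A] [AddCommGroup B] [Module k B]

/-- Left exterior multiplication by a vector. -/
noncomputable def wedge (d : ℕ) : A →ₗ[k] ⋀[k]^d A →ₗ[k] ⋀[k]^(d + 1) A :=
  LinearMap.mk₂ k (fun a w => ⟨ExteriorAlgebra.ι k a * w.1, by
      rw [ExteriorAlgebra.exteriorPower, pow_succ']
      exact Submodule.mul_mem_mul (LinearMap.mem_range_self _ a) w.2⟩)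
    (fun a b w => Subtype.ext (by simp [add_mul]))
    (fun r a w => Subtype.ext (by simp))
    (fun a v w => Subtype.ext (by simp [mul_add]))
    (fun r a w => Subtype.ext (by simp))

lemma coe_wedge (d : ℕ) (a : A) (w : ⋀[k]^d A) :
    (wedge d a w : ExteriorAlgebra k A) = ExteriorAlgebra.ι k a * w := rfl

lemma coe_exteriorPower_map (d : ℕ) (f : A →ₗ[k] B) (w : ⋀[k]^d A) :
    (exteriorPower.map d f w : ExteriorAlgebra k B) = ExteriorAlgebra.map f w := by
  have : (⋀[k]^d B).subtype ∘ₗ exteriorPower.map d f =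
      (ExteriorAlgebra.map f).toLinearMap ∘ₗ (⋀[k]^d A).subtype := by
    apply exteriorPower.linearMap_ext
    ext v
    simp [ExteriorAlgebra.map_apply_ιMulti]
  exact LinearMap.congr_fun this w

lemma map_wedge (d : ℕ) (f : A →ₗ[k] B) (a : A) (w : ⋀[k]^d A) :
    exteriorPower.map (d + 1) f (wedge d a w) = wedge d (f a) (exteriorPower.map d f w) :=
  Subtype.ext (by simp [coe_exteriorPower_map, coe_wedge])

open CliffordAlgebra in
lemma contractLeft_mem (φ : Module.Dual k B) (d : ℕ) : ∀ x ∈ ⋀[k]^(d + 1) B,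
    (contractLeft (Q := (0 : QuadraticForm k B)) φ x : ExteriorAlgebra k B) ∈ ⋀[k]^d B := by
  induction d with
  | zero =>
    intro x hx
    rw [ExteriorAlgebra.exteriorPower, pow_one] at hx
    obtain ⟨b, rfl⟩ := hx
    rw [ExteriorAlgebra.exteriorPower, pow_zero]
    refine Submodule.mem_one.2 ⟨φ b, ?_⟩
    exact (contractLeft_ι _ φ b).symm
  | succ d ih =>
    intro x hx
    rw [ExteriorAlgebra.exteriorPower, pow_succ'] at hx
    induction hx using Submodule.mul_induction_on' with
    | mem_mul_mem y hy z hz =>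
      obtain ⟨b, rfl⟩ := hy
      have := contractLeft_ι_mul (Q := (0 : QuadraticForm k B)) φ b z
      rw [ExteriorAlgebra.ι, this]
      refine Submodule.sub_mem _ (Submodule.smul_mem _ _ hz) ?_
      rw [ExteriorAlgebra.exteriorPower, pow_succ']
      exact Submodule.mul_mem_mul (LinearMap.mem_range_self _ b) (ih z hz)
    | add y _ z _ hy hz =>
      rw [map_add]
      exact Submodule.add_mem _ hy hz

/-- Contraction with a linear form on exterior powers. -/
noncomputable def contract (φ : Module.Dual k B) (d : ℕ) : ⋀[k]^(d + 1) B →ₗ[k] ⋀[k]^d B :=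
  LinearMap.restrict (CliffordAlgebra.contractLeft (Q := (0 : QuadraticForm k B)) φ)
    (contractLeft_mem φ d)

-- This is the expansion Λ(A ⊕ kt) = Λ(A) ⊕ t ∧ Λ(A), in which contraction with `φ` extracts the
-- coefficient of t.
open CliffordAlgebra in
lemma exteriorAlgebra_decomposition (e : B →ₗ[k] B) (t : B) (φ : Module.Dual k B)
    (h : ∀ b, b = e b + φ b • t) (x : ExteriorAlgebra k B) :
    x = ExteriorAlgebra.map e x + ExteriorAlgebra.ι k t *
      ExteriorAlgebra.map e (contractLeft (Q := (0 : QuadraticForm k B)) φ x) := by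
  induction x using CliffordAlgebra.left_induction with
  | algebraMap r =>
    rw [contractLeft_algebraMap, map_zero, mul_zero, add_zero]
    exact ((ExteriorAlgebra.map e).commutes r).symm
  | add x y hx hy =>
    rw [map_add, map_add, map_add, mul_add]
    nth_rw 1 [hx, hy]
    abel
  | ι_mul x b hx =>
    rw [contractLeft_ι_mul, map_sub, map_smul, map_mul, map_mul]
    change ExteriorAlgebra.ι k b * x = ExteriorAlgebra.map e (ExteriorAlgebra.ι k b) * _ +
      _ * (_ - ExteriorAlgebra.map e (ExteriorAlgebra.ι k b) * _)
    rw [ExteriorAlgebra.map_apply_ι]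
    have hb : ExteriorAlgebra.ι k b = ExteriorAlgebra.ι k (e b) + φ b • ExteriorAlgebra.ι k t := by
      rw [← map_smul, ← map_add, ← h]
    have hswap : ExteriorAlgebra.ι k (e b) * ExteriorAlgebra.ι k t =
        -(ExteriorAlgebra.ι k t * ExteriorAlgebra.ι k (e b)) :=
      eq_neg_of_add_eq_zero_left (ExteriorAlgebra.ι_add_mul_swap _ _)
    have htt : ExteriorAlgebra.ι k t * ExteriorAlgebra.ι k t = 0 := ExteriorAlgebra.ι_sq_zero t
    generalize contractLeft φ x = c at hx ⊢
    nth_rw 1 [hx]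
    rw [hb, add_mul, mul_add, mul_add, ← mul_assoc, hswap, smul_mul_assoc, smul_mul_assoc,
      ← mul_assoc (ExteriorAlgebra.ι k t) (ExteriorAlgebra.ι k t), htt, zero_mul, smul_zero,
      mul_sub, mul_smul_comm, neg_mul, mul_assoc]
    abel

open CliffordAlgebra in
lemma contractLeft_map (f : A →ₗ[k] B) (φ : Module.Dual k B) (h : ∀ a, φ (f a) = 0)
    (x : ExteriorAlgebra k A) :
    contractLeft (Q := (0 : QuadraticForm k B)) φ (ExteriorAlgebra.map f x) = 0 := by
  induction x using CliffordAlgebra.left_induction with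
  | algebraMap r =>
    refine (congrArg _ ((ExteriorAlgebra.map f).commutes r)).trans ?_
    exact contractLeft_algebraMap _ φ r
  | add x y hx hy => rw [map_add, map_add, hx, hy, add_zero]
  | ι_mul x a hx =>
    have : ExteriorAlgebra.map f (CliffordAlgebra.ι 0 a * x) =
        CliffordAlgebra.ι 0 (f a) * ExteriorAlgebra.map f x := by
      rw [map_mul]
      exact congrArg (· * _) (ExteriorAlgebra.map_apply_ι f a)
    rw [this, contractLeft_ι_mul, hx, h, zero_smul, mul_zero, sub_zero]

variable {incl : A →ₗ[k] B} {ρ : B →ₗ[k] A} {t : B} {φ : Module.Dual k B}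

/-- Together with `contract_wedge` this identifies the kernel of Λ^(d+1)(ρ) with Λ^d(A), by w ↦ t ∧
w. -/
lemma wedge_contract (h : ∀ b, b = incl (ρ b) + φ b • t) (d : ℕ) (x : ⋀[k]^(d + 1) B)
    (hx : exteriorPower.map (d + 1) ρ x = 0) :
    wedge d t (exteriorPower.map d incl (exteriorPower.map d ρ (contract φ d x))) = x := by
  have h1 := exteriorAlgebra_decomposition (incl ∘ₗ ρ) t φ h x.1
  rw [← coe_exteriorPower_map, exteriorPower.map_comp, LinearMap.comp_apply, hx, map_zero] at h1
  apply Subtype.ext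
  rw [coe_wedge, ← LinearMap.comp_apply, ← exteriorPower.map_comp, coe_exteriorPower_map]
  refine Eq.trans ?_ h1.symm
  rw [Submodule.coe_zero, zero_add]
  rfl

lemma contract_wedge (hρ : ∀ a, ρ (incl a) = a) (hφ : ∀ a, φ (incl a) = 0) (ht : φ t = 1)
    (d : ℕ) (w : ⋀[k]^d A) :
    exteriorPower.map d ρ (contract φ d (wedge d t (exteriorPower.map d incl w))) = w := by
  apply Subtype.ext
  rw [coe_exteriorPower_map]
  change ExteriorAlgebra.map ρ (CliffordAlgebra.contractLeft φ (CliffordAlgebra.ι 0 t * _)) = _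
  rw [CliffordAlgebra.contractLeft_ι_mul, coe_exteriorPower_map, contractLeft_map _ _ hφ, mul_zero,
    sub_zero, ht, one_smul, ← AlgHom.comp_apply, ExteriorAlgebra.map_comp_map,
    show ρ ∘ₗ incl = LinearMap.id from LinearMap.ext hρ, ExteriorAlgebra.map_id, AlgHom.id_apply]

lemma exteriorPower_map_zero_injective (f : A →ₗ[k] B) :
    Function.Injective (exteriorPower.map 0 f) := fun x y h => by
  have := exteriorPower.zeroEquiv_naturality f
  apply (exteriorPower.zeroEquiv k A).injective
  have hx := LinearMap.congr_fun this x
  have hy := LinearMap.congr_fun this y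
  simp only [LinearMap.comp_apply, LinearEquiv.coe_coe] at hx hy
  rw [← hx, ← hy, h]

lemma subsingleton_exteriorPower_succ [Subsingleton A] (d : ℕ) :
    Subsingleton (⋀[k]^(d + 1) A) := by
  have : (LinearMap.id : ⋀[k]^(d + 1) A →ₗ[k] _) = 0 := by
    apply exteriorPower.linearMap_ext
    ext1 v
    change exteriorPower.ιMulti k (d + 1) v = 0
    exact (exteriorPower.ιMulti k (d + 1)).map_coord_zero 0 (Subsingleton.elim _ _)
  exact ⟨fun x y => (LinearMap.congr_fun this x).trans (LinearMap.congr_fun this y).symm⟩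

end Exterior

/-! ### Morphisms from I^⊗n to exterior powers of 𝔞. -/

section HomExterior

open RedGroupRing

variable {k : Type} [CommRing k]

variable (k) in
/-- The exterior powers of the linear abelianization functor. -/
noncomputable def extIndec (d : ℕ) : Fun k := indec k ⋙ ModuleCat.exteriorPower.functor k d

/-- The projection from the reduced group ring functor to the linear abelianization. -/
noncomputable def toIndecL (G : Gr) : (redGroupRing k).obj G →ₗ[k] (indec k).obj G := toIndec G

lemma indec_map_toIndecL {G H : Gr} (f : G ⟶ H) (b : (redGroupRing k).obj G) :
    ((indec k).map f).hom (toIndecL G b) = toIndecL H (((redGroupRing k).map f).hom b) := rfl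

lemma toIndecL_gen_mul (G : Gr) (g h : G.obj) :
    toIndecL G (gen k (g * h)) = toIndecL G (gen k g) + toIndecL G (gen k h) :=
  toIndec_of_mul G g h

lemma indec_hom_ext {G : Gr} {A : Type} [AddCommGroup A] [Module k A]
    {φ ψ : (indec k).obj G →ₗ[k] A} (h : ∀ g, φ (toIndecL G (gen k g)) = ψ (toIndecL G (gen k g))) :
    φ = ψ :=
  Submodule.linearMap_qext _ (RedGroupRing.hom_ext h)

/-- A homomorphism to an abelian group induces a linear map on the linear abelianization. -/
noncomputable def indecLift {G : Gr} {A : Type} [AddCommGroup A] [Module k A]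
    (χ : G.obj →* Multiplicative A) : (indec k).obj G →ₗ[k] A :=
  Submodule.liftQ _ (RedGroupRing.lift (fun g => (χ g).toAdd) (by simp)) (by
    rintro _ ⟨t, rfl⟩
    refine LinearMap.congr_fun (f := RedGroupRing.lift (fun g => (χ g).toAdd) (by simp) ∘ₗ
      TensorProduct.lift mul) (g := 0) (TensorProduct.ext ?_) t
    exact RedGroupRing.hom_ext fun x => RedGroupRing.hom_ext fun y => by simp)

lemma indecLift_gen {G : Gr} {A : Type} [AddCommGroup A] [Module k A]
    (χ : G.obj →* Multiplicative A) (g : G.obj) :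
    indecLift (k := k) χ (toIndecL G (gen k g)) = (χ g).toAdd :=
  RedGroupRing.lift_of (fun g => (χ g).toAdd) (by simp) g

variable (k) in
/-- The exponent of the new generator. -/
noncomputable def exponent (G : Gr) : Module.Dual k ((indec k).obj (adjoin.obj G)) :=
  indecLift (G := adjoin.obj G) (A := k)
    (Monoid.Coprod.lift (1 : G.obj →* Multiplicative k)
      (FreeGroup.lift fun _ : Unit => Multiplicative.ofAdd 1))

lemma exponent_newGen (G : Gr) : exponent k G (toIndecL _ (gen k (newGen G))) = 1 := by
  refine (indecLift_gen _ _).trans ?_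
  refine (congrArg Multiplicative.toAdd (Monoid.Coprod.lift_apply_inr _ _ _)).trans ?_
  simp

lemma exponent_incl_gen (G : Gr) (g : G.obj) :
    exponent k G (toIndecL _ (gen k ((incl G).hom.hom g))) = 0 := by
  refine (indecLift_gen _ _).trans ?_
  exact congrArg Multiplicative.toAdd (Monoid.Coprod.lift_apply_inl _ _ _)

lemma exponent_incl (G : Gr) (a : (indec k).obj G) :
    exponent k G (((indec k).map (incl G)).hom a) = 0 := by
  have : exponent k G ∘ₗ ((indec k).map (incl G)).hom = 0 := indec_hom_ext fun g => by
    rw [LinearMap.comp_apply, indec_map_toIndecL, redGroupRing_map_gen, exponent_incl_gen,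
      LinearMap.zero_apply]
  exact LinearMap.congr_fun this a

/-- Both sides are additive in the group element, so it suffices to compare them on the old group
and on the new generator. -/
lemma indec_adjoin_decomposition (G : Gr) (b : (indec k).obj (adjoin.obj G)) :
    b = ((indec k).map (incl G)).hom (((indec k).map (specialize (1 : G.obj))).hom b) +
      exponent k G b • toIndecL _ (gen k (newGen G)) := by
  let ψ : (indec k).obj (adjoin.obj G) →ₗ[k] (indec k).obj (adjoin.obj G) :=
    ((indec k).map (incl G)).hom ∘ₗ ((indec k).map (specialize (1 : G.obj))).hom +
      (exponent k G).smulRight (toIndecL _ (gen k (newGen G)))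
  let α (θ : (indec k).obj (adjoin.obj G) →ₗ[k] (indec k).obj (adjoin.obj G)) :
      (adjoin.obj G).obj →* Multiplicative ((indec k).obj (adjoin.obj G)) :=
    { toFun := fun g => Multiplicative.ofAdd (θ (toIndecL _ (gen k g)))
      map_one' := by simp
      map_mul' := fun g h => by rw [toIndecL_gen_mul, map_add, ofAdd_add] }
  have hψ (g) : ψ (toIndecL _ (gen k g)) = ((indec k).map (incl G)).hom
      (((indec k).map (specialize (1 : G.obj))).hom (toIndecL _ (gen k g))) +
      exponent k G (toIndecL _ (gen k g)) • toIndecL _ (gen k (newGen G)) := rfl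
  have hα : α LinearMap.id = α ψ := adjoin_hom_ext
    (fun x => congrArg Multiplicative.ofAdd (by
      rw [hψ, exponent_incl_gen, zero_smul, add_zero, indec_map_toIndecL, redGroupRing_map_gen,
        ← GrpCat.comp_apply, ← ObjectProperty.FullSubcategory.comp_hom, incl_specialize,
        indec_map_toIndecL, redGroupRing_map_gen]
      rfl))
    (congrArg Multiplicative.ofAdd (by
      rw [hψ, exponent_newGen, one_smul, indec_map_toIndecL, redGroupRing_map_gen,
        specialize_newGen, gen_one, map_zero, map_zero, zero_add]
      rfl))
  have : LinearMap.id = ψ := indec_hom_ext fun g =>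
    Multiplicative.ofAdd.injective (DFunLike.congr_fun hα g)
  exact LinearMap.congr_fun this b

/-- Exterior multiplication, for the linear abelianization functor. -/
noncomputable def wedgeL (d : ℕ) (G : Gr) :
    (indec k).obj G →ₗ[k] (extIndec k d).obj G →ₗ[k] (extIndec k (d + 1)).obj G :=
  wedge d

lemma extIndec_map_wedgeL (d : ℕ) {G H : Gr} (f : G ⟶ H) (a : (indec k).obj G)
    (w : (extIndec k d).obj G) : ((extIndec k (d + 1)).map f).hom (wedgeL d G a w) =
      wedgeL d H (((indec k).map f).hom a) (((extIndec k d).map f).hom w) :=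
  map_wedge d ((indec k).map f).hom a w

/-- Contraction with the exponent of the new generator. -/
noncomputable def contractNewGen (d : ℕ) (G : Gr) :
    (extIndec k (d + 1)).obj (adjoin.obj G) →ₗ[k] (extIndec k d).obj G :=
  ((extIndec k d).map (specialize (1 : G.obj))).hom ∘ₗ contract (exponent k G) d

lemma contractNewGen_wedgeL (d : ℕ) (G : Gr) (w : (extIndec k d).obj G) :
    contractNewGen d G (wedgeL d (adjoin.obj G) (toIndecL _ (gen k (newGen G)))
      (((extIndec k d).map (incl G)).hom w)) = w :=
  contract_wedge (incl := ((indec k).map (incl G)).hom)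
    (ρ := ((indec k).map (specialize (1 : G.obj))).hom)
    (fun a => by rw [← fun_map_comp, incl_specialize, fun_map_id]) (exponent_incl G)
    (exponent_newGen G) d w

lemma wedgeL_contractNewGen (d : ℕ) (G : Gr) (y : (extIndec k (d + 1)).obj (adjoin.obj G))
    (hy : ((extIndec k (d + 1)).map (specialize (1 : G.obj))).hom y = 0) :
    wedgeL d (adjoin.obj G) (toIndecL _ (gen k (newGen G)))
      (((extIndec k d).map (incl G)).hom (contractNewGen d G y)) = y :=
  wedge_contract (incl := ((indec k).map (incl G)).hom)
    (ρ := ((indec k).map (specialize (1 : G.obj))).hom) (indec_adjoin_decomposition G) d y hy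

/-- The wedge product with the class of an element of the group. -/
noncomputable def wedgeHom {X : Fun k} (d : ℕ) (ψ : X ⟶ extIndec k d) :
    tens (redGroupRing k) X ⟶ extIndec k (d + 1) :=
  tensDesc (fun G => LinearMap.lcomp k _ (ψ.app G).hom ∘ₗ wedgeL d G ∘ₗ toIndecL G)
    fun G H f b x => by
      refine Eq.trans ?_ (extIndec_map_wedgeL d f (toIndecL G b) ((ψ.app G).hom x)).symm
      rw [indec_map_toIndecL, ← natTrans_map]
      rfl

lemma wedgeHom_tm {X : Fun k} (d : ℕ) (ψ : X ⟶ extIndec k d) {G : Gr} (b : (redGroupRing k).obj G)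
    (x : X.obj G) : ((wedgeHom d ψ).app G).hom (tm b x) =
      wedgeL d G (toIndecL G b) ((ψ.app G).hom x) := rfl

lemma universalValue_wedgeHom {X : Fun k} (d : ℕ) (ψ : X ⟶ extIndec k d) (G : Gr) (x : X.obj G) :
    ((universalValue (wedgeHom d ψ)).app G).hom x =
      wedgeL d (adjoin.obj G) (toIndecL _ (gen k (newGen G)))
        (((extIndec k d).map (incl G)).hom ((ψ.app G).hom x)) := by
  rw [universalValue_app, wedgeHom_tm, natTrans_map]

lemma wedgeHom_injective {X : Fun k} (d : ℕ) {ψ ψ' : X ⟶ extIndec k d}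
    (h : wedgeHom d ψ = wedgeHom d ψ') : ψ = ψ' := natTrans_ext fun G x => by
  rw [← contractNewGen_wedgeL d G ((ψ.app G).hom x), ← universalValue_wedgeHom, h,
    universalValue_wedgeHom, contractNewGen_wedgeL]

/-- The universal value of `Φ` is killed by `specialize 1`, hence is the new generator wedged with a
unique element of the d-th exterior power; that element defines ψ. -/
lemma wedgeHom_surjective {X : Fun k} (d : ℕ) (Φ : tens (redGroupRing k) X ⟶ extIndec k (d + 1)) :
    ∃ ψ, wedgeHom d ψ = Φ := by
  have key (G : Gr) (x : X.obj G) : wedgeL d (adjoin.obj G) (toIndecL _ (gen k (newGen G)))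
      (((extIndec k d).map (incl G)).hom
        (contractNewGen d G (((universalValue Φ).app G).hom x))) =
      ((universalValue Φ).app G).hom x :=
    wedgeL_contractNewGen d G _ (map_specialize_one_universalValue Φ G x)
  let ψ : X ⟶ extIndec k d := natTransOfLinear
    (fun G => contractNewGen d G ∘ₗ ((universalValue Φ).app G).hom) fun G H f x => by
      rw [LinearMap.comp_apply, LinearMap.comp_apply]
      have h1 : ((universalValue Φ).app H).hom ((X.map f).hom x) =
        ((extIndec k (d + 1)).map (adjoin.map f)).hom (((universalValue Φ).app G).hom x) :=
          natTrans_map (universalValue Φ) f x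
      -- Naturality of ψ is read off from the normal form `key`, since `adjoin.map f` fixes the new
      -- generator and commutes with `incl`.
      rw [h1, ← key G x, extIndec_map_wedgeL, indec_map_toIndecL, redGroupRing_map_gen,
        adjoin_map_newGen, ← fun_map_comp, incl_adjoin_map, fun_map_comp, contractNewGen_wedgeL,
        key]
  refine ⟨ψ, tens_redGroupRing_ext fun G g x => ?_⟩
  rw [← map_specialize_universalValue Φ, ← key, extIndec_map_wedgeL, indec_map_toIndecL,
    redGroupRing_map_gen, specialize_newGen, ← fun_map_comp, incl_specialize, fun_map_id]
  rfl

lemma wedgeHom_add {X : Fun k} (d : ℕ) (ψ ψ' : X ⟶ extIndec k d) :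
    wedgeHom d (ψ + ψ') = wedgeHom d ψ + wedgeHom d ψ' := tens_natTrans_ext fun G b x =>
  map_add (wedgeL d G (toIndecL G b)) ((ψ.app G).hom x) ((ψ'.app G).hom x)

/-- Morphisms to an exterior power from a tensor product with the reduced group ring. -/
noncomputable def wedgeHomEquiv (X : Fun k) (d : ℕ) :
    (X ⟶ extIndec k d) ≃+ (tens (redGroupRing k) X ⟶ extIndec k (d + 1)) :=
  AddEquiv.ofBijective (AddMonoidHom.mk' (wedgeHom d) (wedgeHom_add d))
    ⟨fun _ _ h => wedgeHom_injective d h, wedgeHom_surjective d⟩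

/-- The functor Λ^0 is constant, so `specialize 1` is injective on it, yet it kills the universal
value. -/
lemma subsingleton_hom_extIndec_zero (X : Fun k) :
    Subsingleton (tens (redGroupRing k) X ⟶ extIndec k 0) := by
  have (Φ : tens (redGroupRing k) X ⟶ extIndec k 0) : Φ = 0 := tens_redGroupRing_ext fun G g x => by
    have h : ((universalValue Φ).app G).hom x = 0 :=
      exteriorPower_map_zero_injective ((indec k).map (specialize (1 : G.obj))).hom
        ((map_specialize_one_universalValue Φ G x).trans (map_zero _).symm)
    rw [← map_specialize_universalValue Φ, h, map_zero]
    rfl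
  exact ⟨fun Φ Φ' => (this Φ).trans (this Φ').symm⟩

variable (k) in
/-- Iterated tensor products with the reduced group ring. -/
noncomputable def tensPow (X : Fun k) : ℕ → Fun k
  | 0 => X
  | n + 1 => tens (redGroupRing k) (tensPow X n)

instance projective_tensPow (X : Fun k) [Projective X] (n : ℕ) : Projective (tensPow k X n) := by
  induction n with
  | zero => assumption
  | succ n ih => exact projective_tens (tensPow k X n)

lemma nonempty_hom_tensPow_extIndec (d : ℕ) :
    Nonempty ((tensPow k (unit k) d ⟶ extIndec k d) ≃+ k) := by
  induction d with
  | zero =>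
    exact ⟨(unitHomEquiv _).trans (exteriorPower.zeroEquiv k ((indec k).obj triv)).toAddEquiv⟩
  | succ d ih => exact ih.map fun e => (wedgeHomEquiv _ d).symm.trans e

lemma subsingleton_indec_triv : Subsingleton ((indec k).obj triv) := by
  have : (LinearMap.id : (indec k).obj triv →ₗ[k] _) = 0 := indec_hom_ext fun g => by
    have : g = 1 := Subsingleton.elim (α := FreeGroup Empty) _ _
    rw [this, gen_one, map_zero, map_zero, map_zero]
  exact ⟨fun x y => (LinearMap.congr_fun this x).trans (LinearMap.congr_fun this y).symm⟩

/-- Cancelling factors I against exterior degrees ends either in maps from I ⊗ X to Λ^0, or in the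
value of a positive exterior power at the trivial group; both vanish. -/
lemma subsingleton_hom_tensPow_extIndec (n : ℕ) : ∀ d, n ≠ d →
    Subsingleton (tensPow k (unit k) n ⟶ extIndec k d) := by
  induction n with
  | zero =>
    rintro (_ | d) h
    · exact absurd rfl h
    · have := subsingleton_indec_triv (k := k)
      have : Subsingleton ((extIndec k (d + 1)).obj triv) :=
        subsingleton_exteriorPower_succ (k := k) (A := (indec k).obj triv) d
      exact (unitHomEquiv (extIndec k (d + 1))).injective.subsingleton
  | succ n ih =>
    rintro (_ | d) h
    · exact subsingleton_hom_extIndec_zero _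
    · have := ih d (by lia)
      exact (wedgeHomEquiv (tensPow k (unit k) n) d).symm.injective.subsingleton

end HomExterior

end FunctorsOnFreeGroups

namespace FunctorsOnFreeGroups

/-! ### Tensor powers in iterated form. -/

section TensorPowers

variable {k : Type} [CommRing k]

/-- The pointwise tensor power of a functor. -/
noncomputable def tensorPowerFun (X : Fun k) (c : ℕ) : Fun k where
  obj G := ModuleCat.of k (⨂[k]^c (X.obj G))
  map f := ModuleCat.ofHom (PiTensorProduct.map fun _ : Fin c => (X.map f).hom)
  map_id G := by
    apply ModuleCat.hom_ext
    simp
  map_comp f g := by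
    apply ModuleCat.hom_ext
    simp [PiTensorProduct.map_comp]

/-- The zeroth tensor power is constant. -/
noncomputable def tensorPowerFunZero (X : Fun k) : tensorPowerFun X 0 ≅ unit k :=
  natIsoOfLinear (X := tensorPowerFun X 0) (Y := unit k)
    (fun G => PiTensorProduct.isEmptyEquiv (Fin 0)) fun G H f t => by
    refine LinearMap.congr_fun (f := (PiTensorProduct.isEmptyEquiv (Fin 0)).toLinearMap ∘ₗ
      PiTensorProduct.map fun _ : Fin 0 => (X.map f).hom)
      (g := (PiTensorProduct.isEmptyEquiv (Fin 0)).toLinearMap) (PiTensorProduct.ext ?_) t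
    ext v
    simp

/-- Splitting off the first tensor factor. -/
noncomputable def tensorPowerSuccEquiv (A : Type) [AddCommGroup A] [Module k A] (c : ℕ) :
    A ⊗[k] (⨂[k]^c A) ≃ₗ[k] ⨂[k]^(c + 1) A :=
  (TensorProduct.congr (PiTensorProduct.subsingletonEquiv (R := k) (s := fun _ : Fin 1 => A) 0).symm
    (LinearEquiv.refl k _)).trans
    (TensorPower.mulEquiv.trans (TensorPower.cast k A (add_comm 1 c)))

lemma tensorPowerSuccEquiv_tprod (A : Type) [AddCommGroup A] [Module k A] (c : ℕ) (a : A)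
    (v : Fin c → A) : tensorPowerSuccEquiv A c (a ⊗ₜ[k] PiTensorProduct.tprod k v) =
      PiTensorProduct.tprod k (Fin.append (fun _ : Fin 1 => a) v ∘ Fin.cast (add_comm c 1)) := by
  rw [tensorPowerSuccEquiv, LinearEquiv.trans_apply, LinearEquiv.trans_apply,
    TensorProduct.congr_tmul, ← TensorPower.cast_tprod k A (add_comm 1 c)]
  congr 1
  refine Eq.trans ?_ (TensorPower.tprod_mul_tprod k (fun _ : Fin 1 => a) v)
  rw [TensorPower.gMul_def]
  congr 2
  rw [LinearEquiv.symm_apply_eq, PiTensorProduct.subsingletonEquiv_apply_tprod]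

/-- The recursion for tensor powers. -/
noncomputable def tensorPowerFunSucc (X : Fun k) (c : ℕ) :
    tens X (tensorPowerFun X c) ≅ tensorPowerFun X (c + 1) :=
  natIsoOfLinear (X := tens X (tensorPowerFun X c)) (Y := tensorPowerFun X (c + 1))
    (fun G => tensorPowerSuccEquiv (X.obj G) c) fun G H f t => by
    refine LinearMap.congr_fun (f := (tensorPowerSuccEquiv (X.obj H) c).toLinearMap ∘ₗ
      TensorProduct.map (X.map f).hom (PiTensorProduct.map fun _ : Fin c => (X.map f).hom))
      (g := (PiTensorProduct.map fun _ : Fin (c + 1) => (X.map f).hom) ∘ₗ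
        (tensorPowerSuccEquiv (X.obj G) c).toLinearMap)
      (TensorProduct.ext (LinearMap.ext fun a => PiTensorProduct.ext ?_)) t
    ext v
    have h (i : Fin (1 + c)) : (X.map f).hom (Fin.append (fun _ : Fin 1 => a) v i) =
        Fin.append (fun _ : Fin 1 => (X.map f).hom a) (fun j => (X.map f).hom (v j)) i := by
      refine Fin.addCases (fun j => ?_) (fun j => ?_) i <;> simp
    simp only [LinearMap.compMultilinearMap_apply, LinearMap.compr₂ₛₗ_apply, LinearMap.comp_apply,
      TensorProduct.mk_apply, TensorProduct.map_tmul, PiTensorProduct.map_tprod,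
      LinearEquiv.coe_coe, tensorPowerSuccEquiv_tprod, Function.comp_apply, h]
    rfl

variable (k) in
/-- The tensor powers of the linear abelianization functor. -/
noncomputable def indecPow : ℕ → Fun k
  | 0 => unit k
  | c + 1 => tens (indec k) (indecPow c)

/-- Tensor powers of a functor isomorphic to the linear abelianization functor. -/
noncomputable def tensorPowerFunIso {X : Fun k} (e : X ≅ indec k) :
    ∀ c, tensorPowerFun X c ≅ indecPow k c
  | 0 => tensorPowerFunZero X
  | c + 1 => (tensorPowerFunSucc X c).symm ≪≫ tensIso e (tensorPowerFunIso e c)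

/-- Moving a factor past the iterated tensor product with the reduced group ring. -/
noncomputable def tensTensPow (X Y : Fun k) : ∀ n, tens X (tensPow k Y n) ≅ tensPow k (tens X Y) n
  | 0 => Iso.refl _
  | n + 1 => tensLeftComm X (redGroupRing k) (tensPow k Y n) ≪≫
      tensIso (Iso.refl _) (tensTensPow X Y n)

lemma tensPow_tensPow (X : Fun k) (n m : ℕ) :
    tensPow k (tensPow k X n) m = tensPow k X (n + m) := by
  induction m with
  | zero => rfl
  | succ m ih => exact congrArg (tens (redGroupRing k)) ih

lemma bar_carrier (W : Fun k) (n : ℕ) : (RedModule.bar W n).carrier = tensPow k W n := by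
  induction n with
  | zero => rfl
  | succ n ih => exact congrArg (tens (redGroupRing k)) ih

end TensorPowers

/-! ### The isomorphism of 𝔞 with I/I² over ℤ. -/

section Abelianization

/-- An additive map between `ℤ`-modules is linear. -/
def linOfAdd {A B : Type} [AddCommGroup A] [Module ℤ A] [AddCommGroup B] [Module ℤ B]
    (f : A →+ B) : A →ₗ[ℤ] B where
  toFun := f
  map_add' := f.map_add
  map_smul' n x := map_intCast_smul f ℤ ℤ n x

/-- The class of a group element in the abelianization. -/
noncomputable def abOf (G : Gr) (g : G.obj) : 𝔞.obj G :=
  (Additive.ofMul (Abelianization.of g) : Additive (Abelianization G.obj))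

lemma abOf_mul (G : Gr) (g h : G.obj) : abOf G (g * h) = abOf G g + abOf G h :=
  congrArg (fun x : Abelianization G.obj => (Additive.ofMul x : Additive (Abelianization G.obj)))
    (map_mul Abelianization.of g h)

lemma abOf_surjective (G : Gr) : Function.Surjective (abOf G) :=
  fun x => QuotientGroup.mk_surjective (Additive.toMul (α := Abelianization G.obj) x)

lemma abelianization_map_abOf {G H : Gr} (f : G ⟶ H) (g : G.obj) :
    (𝔞.map f).hom (abOf G g) = abOf H (f.hom.hom g) :=
  rfl

/-- The natural map from the linear abelianization over `ℤ` to the abelianization. -/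
noncomputable def indecToAb (G : Gr) : (indec ℤ).obj G →ₗ[ℤ] 𝔞.obj G :=
  indecLift (G := G) (A := 𝔞.obj G)
    (MonoidHom.mk' (fun g => Multiplicative.ofAdd (abOf G g))
      fun g h => by rw [abOf_mul, ofAdd_add])

lemma indecToAb_gen (G : Gr) (g : G.obj) :
    indecToAb G (toIndecL G (gen ℤ g)) = abOf G g :=
  indecLift_gen _ _

/-- The inverse of `indecToAb`. -/
noncomputable def abToIndec (G : Gr) : 𝔞.obj G →ₗ[ℤ] (indec ℤ).obj G :=
  linOfAdd (A := Additive (Abelianization G.obj)) (MonoidHom.toAdditiveLeft (Abelianization.lift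
    (MonoidHom.mk' (fun g => Multiplicative.ofAdd (toIndecL G (gen ℤ g)))
      fun g h => by rw [toIndecL_gen_mul, ofAdd_add])))

lemma abToIndec_of (G : Gr) (g : G.obj) :
    abToIndec G (abOf G g) = toIndecL G (gen ℤ g) := rfl

/-- The abelianization functor is the linear abelianization functor over `ℤ`. -/
noncomputable def abIso : 𝔞 ≅ indec ℤ :=
  (natIsoOfLinear (X := indec ℤ) (Y := 𝔞)
    (fun G => LinearEquiv.ofLinearMap (indecToAb G) (abToIndec G)
      (LinearMap.ext fun x => by
        obtain ⟨g, rfl⟩ := abOf_surjective G x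
        rw [LinearMap.comp_apply, abToIndec_of, indecToAb_gen]
        rfl)
      (indec_hom_ext fun g => by
        rw [LinearMap.comp_apply, indecToAb_gen, abToIndec_of]
        rfl)) fun G H f x => by
    have : indecToAb H ∘ₗ ((indec ℤ).map f).hom = (𝔞.map f).hom ∘ₗ indecToAb G :=
      indec_hom_ext fun g => by
        rw [LinearMap.comp_apply, indec_map_toIndecL, redGroupRing_map_gen, indecToAb_gen,
          LinearMap.comp_apply, indecToAb_gen, abelianization_map_abOf]
    exact LinearMap.congr_fun this x).symm

/-- The tensor powers of the abelianization functor. -/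
noncomputable def abTensorPowerIso (c : ℕ) : 𝔞 ⋙ tensorPower c ≅ indecPow ℤ c :=
  tensorPowerFunIso abIso c

/-- The exterior powers of the abelianization functor. -/
noncomputable def abExteriorPowerIso (d : ℕ) : 𝔞 ⋙ exteriorPower d ≅ extIndec ℤ d :=
  Functor.isoWhiskerRight abIso _

end Abelianization

/-! ### The Ext computation, by induction on the number of factors 𝔞. -/

section Ext

open Abelian

/-- The compositions of `d - n` into `b` positive parts. -/
abbrev Parts (d n b : ℕ) : Type := {f : Fin b → ℕ // n + ∑ i, (f i + 1) = d}

/-- Splitting off the first part. -/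
def partsSucc (d n b : ℕ) : (Σ j : ℕ, Parts d (n + (j + 1)) b) ≃ Parts d n (b + 1) where
  toFun p := ⟨Fin.cons p.1 p.2.1, by
    have := p.2.2
    simp only [Fin.sum_univ_succ, Fin.cons_zero, Fin.cons_succ]
    lia⟩
  invFun f := ⟨f.1 0, Fin.tail f.1, by
    have := f.2
    simp only [Fin.sum_univ_succ] at this
    simp only [Fin.tail]
    lia⟩
  left_inv p := rfl
  right_inv f := Subtype.ext (Fin.cons_self_tail f.1)

lemma isEmpty_parts {d n b : ℕ} (h : (d : ℤ) - n - b < 0) : IsEmpty (Parts d n b) := by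
  refine ⟨fun f => ?_⟩
  have h1 := f.2
  rw [Finset.sum_add_distrib] at h1
  simp only [Finset.sum_const, Finset.card_univ, Fintype.card_fin, smul_eq_mul, mul_one] at h1
  lia

/-- The source is projective, so only Hom matters; it is ℤ or zero according to whether n = d, and
`Parts d n 0` correspondingly has one element or none. -/
lemma extConcentrated_zero (d n : ℕ) :
    ExtConcentrated (tensPow ℤ (indecPow ℤ 0) n) (extIndec ℤ d) (d - n - (0 : ℕ))
      (Parts d n 0) := by
  have : Projective (tensPow ℤ (indecPow ℤ 0) n) := projective_tensPow (unit ℤ) n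
  refine ⟨isEmpty_parts, fun i hi => ?_, fun i hi => ?_⟩
  · obtain _ | i := i
    · obtain rfl : n = d := by lia
      have : Subsingleton (Parts n n 0) :=
        ⟨fun f g => Subtype.ext (funext fun i => i.elim0)⟩
      exact (nonempty_hom_tensPow_extIndec (k := ℤ) n).map fun e => Ext.addEquiv₀.trans
        (e.trans (Finsupp.uniqueAddEquiv (⟨Fin.elim0, by simp⟩ : Parts n n 0)).symm)
    · have : IsEmpty (Parts d n 0) := ⟨fun f => by
        have := f.2
        simp at this
        push_cast at hi
        lia⟩
      have := Ext.subsingleton_of_projective (tensPow ℤ (indecPow ℤ 0) n) (extIndec ℤ d) i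
      exact ⟨⟨⟨fun _ => 0, fun _ => 0, fun x => Subsingleton.elim _ _,
        fun x => Subsingleton.elim _ _⟩,
        fun x y => (add_zero _).symm⟩⟩
  · obtain _ | i := i
    · have : Subsingleton (tensPow ℤ (indecPow ℤ 0) n ⟶ extIndec ℤ d) :=
        subsingleton_hom_tensPow_extIndec (k := ℤ) n d (by rintro rfl; simp at hi)
      exact Ext.addEquiv₀.injective.subsingleton
    · exact Ext.subsingleton_of_projective (tensPow ℤ (indecPow ℤ 0) n) (extIndec ℤ d) i

/-- Resolve one factor 𝔞 by the bar complex. Its j-th term is I^⊗(n+j+1) ⊗ 𝔞^⊗b, which by induction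
contributes in degree d - (n+j+1) - b; the shift by j makes this d - n - (b+1) for every j. The
index j is the new part minus one. -/
lemma extConcentrated_tensPow (d b : ℕ) : ∀ n : ℕ,
    ExtConcentrated (tensPow ℤ (indecPow ℤ b) n) (extIndec ℤ d) (d - n - b) (Parts d n b) := by
  induction b with
  | zero => exact extConcentrated_zero d
  | succ b ih =>
    intro n
    have h := isLeftResolution_bar (tensPow ℤ (indecPow ℤ b) n)
    have h2 := h.extConcentrated (F := extIndec ℤ d) (e := d - n - (b + 1 : ℕ))
      (S := fun j => Parts d (n + (j + 1)) b) (d + 1) (by push_cast; lia) fun j => by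
        rw [bar_carrier, tensPow_tensPow]
        exact (ih (n + (j + 1))).of_equiv (by push_cast; ring) (Equiv.refl _)
    exact (h2.of_equiv rfl (partsSucc d n b)).of_iso (tensTensPow _ _ n)

end Ext

/-! ### Orbits of surjections and compositions. -/

section Surjections

lemma card_fiber_pos {d c : ℕ} (f : Surj d c) (i : Fin c) : 0 < Fintype.card {x // f.1 x = i} := by
  obtain ⟨x, hx⟩ := f.2 i
  exact Fintype.card_pos_iff.2 ⟨⟨x, hx⟩⟩

/-- The composition of `d` given by the sizes of the fibres of a surjection. -/
def fiberSizes {d c : ℕ} (f : Surj d c) : Parts d 0 c :=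
  ⟨fun i => Fintype.card {x // f.1 x = i} - 1, by
    -- The truncated subtraction loses nothing, because the fibres of a surjection are nonempty.
    rw [zero_add, Finset.sum_congr rfl fun i _ => Nat.sub_add_cancel (card_fiber_pos f i),
      ← Fintype.card_sigma, Fintype.card_congr (Equiv.sigmaFiberEquiv f.1), Fintype.card_fin]⟩

lemma fiberSizes_eq_iff {d c : ℕ} (f g : Surj d c) :
    fiberSizes f = fiberSizes g ↔ (surjSetoid d c).r f g := by
  have h0 : fiberSizes f = fiberSizes g ↔
      ∀ i, Fintype.card {x // f.1 x = i} = Fintype.card {x // g.1 x = i} := by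
    rw [Subtype.ext_iff, funext_iff]
    refine forall_congr' fun i => ?_
    have h1 := card_fiber_pos f i
    have h2 := card_fiber_pos g i
    simp only [fiberSizes]
    lia
  rw [h0]
  constructor
  · intro h
    -- Bijections between fibres of equal size glue to a permutation of the source.
    let e : ∀ i, {x // g.1 x = i} ≃ {x // f.1 x = i} := fun i => Fintype.equivOfCardEq (h i).symm
    refine ⟨(Equiv.sigmaFiberEquiv g.1).symm.trans
      ((Equiv.sigmaCongrRight e).trans (Equiv.sigmaFiberEquiv f.1)), fun x => ?_⟩
    exact (e (g.1 x) ⟨x, rfl⟩).2.symm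
  · rintro ⟨σ, hσ⟩ i
    exact (Fintype.card_congr (σ.subtypeEquiv fun x => by rw [hσ])).symm

lemma fiberSizes_surjective {d c : ℕ} (p : Parts d 0 c) : ∃ f : Surj d c, fiberSizes f = p := by
  obtain ⟨p, hp⟩ := p
  obtain rfl : ∑ i, (p i + 1) = d := by lia
  -- Cut the source into consecutive blocks of the prescribed sizes and send each block to its
  -- index.
  let e : (Σ i, Fin (p i + 1)) ≃ Fin (∑ i, (p i + 1)) := finSigmaFinEquiv
  refine ⟨⟨fun x => (e.symm x).1, fun i => ⟨e ⟨i, 0⟩, by simp⟩⟩, Subtype.ext (funext fun i => ?_)⟩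
  have : Fintype.card {x // (e.symm x).1 = i} = p i + 1 := by
    rw [Fintype.card_congr ((e.symm.subtypeEquiv fun x => Iff.rfl).trans (Equiv.sigmaSubtype i)),
      Fintype.card_fin]
  simp only [fiberSizes]
  rw [this, Nat.add_sub_cancel]

/-- Ordered partitions are classified by the sizes of their parts. -/
lemma nonempty_parts_equiv_R (d c : ℕ) : Nonempty (Parts d 0 c ≃ R d c) := by
  let F : R d c → Parts d 0 c := Quotient.lift fiberSizes fun f g h => (fiberSizes_eq_iff f g).2 h
  refine ⟨(Equiv.ofBijective F ⟨?_, fun p => ?_⟩).symm⟩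
  · rintro ⟨f⟩ ⟨g⟩ h
    exact Quotient.sound ((fiberSizes_eq_iff f g).1 h)
  · obtain ⟨f, hf⟩ := fiberSizes_surjective p
    exact ⟨Quotient.mk _ f, hf⟩

end Surjections

end FunctorsOnFreeGroups

open FunctorsOnFreeGroups in
lemma extConcentrated_tensorPower_exteriorPower (c d : ℕ) :
    ExtConcentrated (𝔞 ⋙ tensorPower c) (𝔞 ⋙ exteriorPower d) (d - c) (R d c) := by
  obtain ⟨φ⟩ := nonempty_parts_equiv_R d c
  exact (((extConcentrated_tensPow d c 0).of_equiv (by simp) φ).of_iso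
    (abTensorPowerIso c).symm).of_iso_right (abExteriorPowerIso d).symm

theorem proposition202508281110 (c d : ℕ) (hc : 1 ≤ c) (hd : 1 ≤ d) :
    (∀ i : ℕ, (i : ℤ) = (d : ℤ) - (c : ℤ) →
      Nonempty (Abelian.Ext
          (FunctorsOnFreeGroups.𝔞 ⋙ FunctorsOnFreeGroups.tensorPower c)
          (FunctorsOnFreeGroups.𝔞 ⋙ FunctorsOnFreeGroups.exteriorPower d) i ≃+
        (FunctorsOnFreeGroups.R d c →₀ ℤ))) ∧
    (∀ i : ℕ, (i : ℤ) ≠ (d : ℤ) - (c : ℤ) →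
      Subsingleton (Abelian.Ext
        (FunctorsOnFreeGroups.𝔞 ⋙ FunctorsOnFreeGroups.tensorPower c)
        (FunctorsOnFreeGroups.𝔞 ⋙ FunctorsOnFreeGroups.exteriorPower d) i)) :=
  ⟨(extConcentrated_tensorPower_exteriorPower c d).equiv,
    (extConcentrated_tensorPower_exteriorPower c d).subsingleton⟩
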